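/- **Setting.** Let $\beta\in[0,1)$, let $\mathsf Z$ be a Borel subset of $\mathbb R^m$, and let $(z_t,\zeta_t,\eta_t)_{t\ge 1}$ be iid, where $z_t$ is $\mathsf Z$-valued, $\zeta_t$ and $\eta_t$ take values in measurable spaces, and $z_t,\zeta_t,\eta_t$ are mutually independent for each $t$. Let $R_t=R(z_t,\zeta_t)$ and $Y_t=Y(z_t,\eta_t)$, where $R,Y\ge 0$ are real-valued and measurable (so $(R_t,Y_t)$ is iid, while $R_t$ and $Y_t$ may depend on each other through $z_t$). Write $(\hat z,\hat R,\hat Y)$ for a copy of $(z_t,R_t,Y_t)$. A *feasible policy* is a Borel function $c$ on $(0,\infty)\times\mathsf Z$ with $0\le c(a,z)\le a$, extended by $c(0,z)=0$. Its asset path from $(a_0,z_0)=(a,z)$ is $a_{t+1}=R_{t+1}(a_t-c(a_t,z_t))+Y_{t+1}$, and its lifetime value is $V_c(a,z)=\mathbb E_{a,z}\sum_{t\ge 0}\beta^t u(c(a_t,z_t))$. A feasible policy $c^*$ is *optimal* if $V_c\le V_{c^*}$ on $(0,\infty)\times\mathsf Z$ for every feasible $c$. Let $\mathscr C$ be the set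 of functions $c$ on $(0,\infty)\times\mathsf Z$ that are continuous, increasing in the first argument, satisfy $0<c(a,z)\le a$, and satisfy $\sup_{a,z}|u'(c(a,z))-u'(a)|<\infty$. **Assumptions** (with $u'(0)=\infty$ and $0\cdot\infty=0$). 1. $u:[0,\infty)\to\mathbb R\cup\{-\infty\}$ is finite and twice differentiable on $(0,\infty)$ with $u'>0$, $u''<0$ there, $u(0)\le\lim_{c\downarrow0}u(c)$, $u'(c)\to\infty$ as $c\downarrow 0$ and $u'(c)\to 0$ as $c\to\infty$. 2. $\beta^n\,\mathbb E R_1\cdots R_n<1$ for some $n\in\mathbb N$. 3. $\sum_{t\ge1}\beta^t\,\mathbb E Y_t<\infty$. 4. $\mathbb E\hat R<\infty$, $\mathbb E u'(\hat Y)<\infty$ and $\mathbb E\hat R\,u'(\hat Y)<\infty$. 5. $z\mapsto R(z,\zeta)$ and $z\mapsto Y(z,\eta)$ are continuous for all $\zeta,\eta$. 6. There is $\alpha\in(0,1)$ such that $\beta\,\mathbb E\hat R\,u'[\hat R(1-\alpha)a]\le u'(a)$ for all $a>0$, and $(1-\alpha)^n\,\mathbb E R_1\cdots R_n<1$ for some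 $n\in\mathbb N$. 7. $\sup_{t\ge1}\mathbb E Y_t<\infty$. 8. For every $c\in\mathscr C$ that is concave in its first argument, the map $s\mapsto (u')^{-1}\bigl[\beta\,\mathbb E\hat R\,(u'\circ c)(\hat R s+\hat Y,\hat z)\bigr]$ is concave on $[0,\infty)$ (a condition that is void if $\beta\hat R=0$ almost surely, when the bracket is identically $0$). **Theorem.** Under these assumptions there is a unique optimal policy $c^*$; it belongs to $\mathscr C$ and depends on wealth only, $c^*(a,z)=c^*(a)$. Let $Q$ be the stochastic kernel on $[0,\infty)$ of the wealth process $$a_{t+1}=R_{t+1}\,[a_t-c^*(a_t)]+Y_{t+1}.$$ Then $Q$ is globally stable: it has a unique stationary distribution $\psi$ among the Borel probability measures on $[0,\infty)$, and for every Borel probability measure $\psi_0$ on $[0,\infty)$ the measures $\psi_0Q^t$ converge weakly to $\psi$ as $t\to\infty$. -/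

import Mathlib

open MeasureTheory ProbabilityTheory Filter Topology Set
open scoped NNReal ENNReal BoundedContinuousFunction

/-- The primitives of the income fluctuation problem with an iid exogenous state.
`Z` is the space of the exogenous state, `E` and `F` are the spaces of the innovations to
returns and to labour income. The state `z_t` is iid with law `lawZ`, that is, its Markov kernel
is `P(z, ·) = lawZ` for every `z`. -/
structure IncomeFluctuation (Z E F : Type*) [MeasurableSpace Z] [MeasurableSpace E]
    [MeasurableSpace F] where
  /-- discount factor -/
  β : ℝ≥0
  β_lt_one : β < 1
  /-- utility on `[0, ∞)`, with values in `ℝ ∪ {-∞}` -/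
  u : ℝ≥0 → EReal
  /-- gross return as a function of the exogenous state and the innovation -/
  R : Z × E → ℝ≥0
  measurable_R : Measurable R
  /-- labour income as a function of the exogenous state and the innovation -/
  Y : Z × F → ℝ≥0
  measurable_Y : Measurable Y
  /-- law of `z_t`, `t ≥ 1` -/
  lawZ : Measure Z
  isProb_lawZ : IsProbabilityMeasure lawZ
  /-- law of the return innovations -/
  lawζ : Measure E
  isProb_lawζ : IsProbabilityMeasure lawζ
  /-- law of the income innovations -/
  lawη : Measure F
  isProb_lawη : IsProbabilityMeasure lawη

namespace IncomeFluctuation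

noncomputable section

variable {Z E F : Type*} [MeasurableSpace Z] [MeasurableSpace E] [MeasurableSpace F]

/-- The utility as a real function; only its values on `(0, ∞)`, where `u` is finite, matter. -/
def uReal (M : IncomeFluctuation Z E F) (x : ℝ) : ℝ := (M.u x.toNNReal).toReal

/-- Marginal utility `u'` on `(0, ∞)`. -/
def u' (M : IncomeFluctuation Z E F) : ℝ → ℝ := deriv M.uReal

/-- Marginal utility as a function from `[0, ∞)` to `[0, ∞]`, with `u'(0) = ∞`.
Products with it follow the convention `0 * ∞ = 0`. -/
def marg (M : IncomeFluctuation Z E F) (x : ℝ≥0) : ℝ≥0∞ :=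
  if x = 0 then ⊤ else ENNReal.ofReal (M.u' x)

/-- The standing assumption on the utility function. The field `zero_le` says that the value at
zero does not exceed the limit at zero, i.e. that `u` is increasing (equivalently, concave) on
all of `[0, ∞)`. -/
structure UtilityAssumption (M : IncomeFluctuation Z E F) : Prop where
  ne_top : ∀ x, M.u x ≠ ⊤
  ne_bot : ∀ x, 0 < x → M.u x ≠ ⊥
  zero_le : ∀ x, 0 < x → M.u 0 ≤ M.u x
  differentiableAt : ∀ x : ℝ, 0 < x → DifferentiableAt ℝ M.uReal x
  differentiableAt_deriv : ∀ x : ℝ, 0 < x → DifferentiableAt ℝ M.u' x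
  deriv_pos : ∀ x : ℝ, 0 < x → 0 < M.u' x
  deriv2_neg : ∀ x : ℝ, 0 < x → deriv M.u' x < 0
  tendsto_zero : Tendsto M.u' (𝓝[>] 0) atTop
  tendsto_atTop : Tendsto M.u' atTop (𝓝 0)

/-- The law of one period's shocks `(z_t, ζ_t, η_t)`. -/
def shock (M : IncomeFluctuation Z E F) : Measure (Z × E × F) :=
  M.lawZ.prod (M.lawζ.prod M.lawη)

instance (M : IncomeFluctuation Z E F) : IsProbabilityMeasure M.shock := by
  have := M.isProb_lawZ
  have := M.isProb_lawζ
  have := M.isProb_lawη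
  unfold shock
  infer_instance

/-- The return in a period with shocks `w = (z, ζ, η)`. -/
def ret (M : IncomeFluctuation Z E F) (w : Z × E × F) : ℝ≥0 := M.R (w.1, w.2.1)

/-- The labour income in a period with shocks `w = (z, ζ, η)`. -/
def inc (M : IncomeFluctuation Z E F) (w : Z × E × F) : ℝ≥0 := M.Y (w.1, w.2.2)

/-- The law of the whole sequence of shocks; coordinate `t` of `ω : ℕ → Z × E × F` is
`(z_{t+1}, ζ_{t+1}, η_{t+1})`. The law does not depend on `z_0`, so `𝔼_z` is the expectation
under this measure, with `z_0 = z` put in by hand where it enters. -/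
def pathLaw (M : IncomeFluctuation Z E F) : Measure (ℕ → Z × E × F) :=
  Measure.infinitePi fun _ => M.shock

/-- `𝔼 R_1 ⋯ R_n`. -/
def expProdRet (M : IncomeFluctuation Z E F) (n : ℕ) : ℝ≥0∞ :=
  ∫⁻ ω, ∏ t ∈ Finset.range n, (M.ret (ω t) : ℝ≥0∞) ∂M.pathLaw

/-- `𝔼 Y_{t+1}`. -/
def expInc (M : IncomeFluctuation Z E F) (t : ℕ) : ℝ≥0∞ :=
  ∫⁻ ω, (M.inc (ω t) : ℝ≥0∞) ∂M.pathLaw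

/-- There is `n` with `β ^ n 𝔼 R_1 ⋯ R_n < 1`. -/
def ContractionAssumption (M : IncomeFluctuation Z E F) : Prop :=
  ∃ n : ℕ, (M.β : ℝ≥0∞) ^ n * M.expProdRet n < 1

/-- `∑_{t ≥ 1} β ^ t 𝔼 Y_t < ∞`. -/
def IncomeSumAssumption (M : IncomeFluctuation Z E F) : Prop :=
  (∑' t : ℕ, (M.β : ℝ≥0∞) ^ (t + 1) * M.expInc t) < ⊤

/-- `𝔼 R`, `𝔼 u'(Y)` and `𝔼 R u'(Y)` are finite. -/
def MomentAssumption (M : IncomeFluctuation Z E F) : Prop :=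
  (∫⁻ w, (M.ret w : ℝ≥0∞) ∂M.shock) < ⊤ ∧
  (∫⁻ w, M.marg (M.inc w) ∂M.shock) < ⊤ ∧
  (∫⁻ w, (M.ret w : ℝ≥0∞) * M.marg (M.inc w) ∂M.shock) < ⊤

/-- Continuity of `R` and `Y` in the exogenous state. (The further requirement that `𝔼_z R` and
`𝔼_z R u'(Y)` be continuous in `z` is void here: they do not depend on `z`.) -/
def ContinuityAssumption [TopologicalSpace Z] (M : IncomeFluctuation Z E F) : Prop :=
  (∀ ζ, Continuous fun z => M.R (z, ζ)) ∧ ∀ η, Continuous fun z => M.Y (z, η)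

/-- There is `α ∈ (0, 1)` with `β 𝔼 R u'(R (1 - α) a) ≤ u'(a)` for all `a > 0` and
`(1 - α) ^ n 𝔼 R_1 ⋯ R_n < 1` for some `n`. -/
def SavingAssumption (M : IncomeFluctuation Z E F) : Prop :=
  ∃ α : ℝ≥0, 0 < α ∧ α < 1 ∧
    (∀ a : ℝ≥0, 0 < a →
      (M.β : ℝ≥0∞) * ∫⁻ w, (M.ret w : ℝ≥0∞) * M.marg (M.ret w * (1 - α) * a) ∂M.shock
        ≤ M.marg a) ∧
    ∃ n : ℕ, ((1 - α : ℝ≥0) : ℝ≥0∞) ^ n * M.expProdRet n < 1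

/-- `sup_{t ≥ 1} 𝔼 Y_t < ∞`. -/
def IncomeBoundAssumption (M : IncomeFluctuation Z E F) : Prop :=
  (⨆ t : ℕ, M.expInc t) < ⊤

/-- A feasible policy: a Borel function `c` with `0 ≤ c(a, z) ≤ a`. Policies are functions on
`[0, ∞) × Z`; the inequality forces `c(0, z) = 0`, so this is the same as a policy on
`(0, ∞) × Z` extended by zero. -/
structure Feasible (c : ℝ≥0 × Z → ℝ≥0) : Prop where
  measurable : Measurable c
  le : ∀ a z, c (a, z) ≤ a

/-- The class `𝒞` of candidate policies. -/
structure Candidate [TopologicalSpace Z] (M : IncomeFluctuation Z E F)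
    (c : ℝ≥0 × Z → ℝ≥0) : Prop where
  continuousOn : ContinuousOn c {s | 0 < s.1}
  mono : ∀ (a b : ℝ≥0) (z : Z), 0 < a → a ≤ b → c (a, z) ≤ c (b, z)
  pos : ∀ (a : ℝ≥0) (z : Z), 0 < a → 0 < c (a, z)
  le : ∀ (a : ℝ≥0) (z : Z), c (a, z) ≤ a
  bounded : ∃ K : ℝ, ∀ (a : ℝ≥0) (z : Z), 0 < a → |M.u' (c (a, z)) - M.u' a| ≤ K

/-- The inverse of `u' : (0, ∞) → (0, ∞)`. -/
def u'Inv (M : IncomeFluctuation Z E F) (y : ℝ) : ℝ :=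
  Function.invFunOn M.u' (Ioi 0) y

/-- For each candidate policy `c` that is concave in wealth, the map
`s ↦ (u')⁻¹ [β 𝔼 R (u' ∘ c)(R s + Y, z)]` is concave on `[0, ∞)`. The expectation is finite; it
vanishes only if `β = 0` or `R = 0` almost surely, when it does so for every `s` and the
condition holds trivially. -/
def ConcavityAssumption [TopologicalSpace Z] (M : IncomeFluctuation Z E F) : Prop :=
  ∀ c : ℝ≥0 × Z → ℝ≥0, M.Candidate c →
    (∀ z, ConcaveOn ℝ (Ioi 0) fun a : ℝ => (c (a.toNNReal, z) : ℝ)) →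
    ConcaveOn ℝ (Ici 0) fun s : ℝ =>
      M.u'Inv ((M.β : ℝ≥0∞) * ∫⁻ w, (M.ret w : ℝ≥0∞) *
        M.marg (c (M.ret w * s.toNNReal + M.inc w, w.1)) ∂M.shock).toReal

/-- Next period's wealth, when `b` is saved and the shocks are `w`. -/
def nextWealth (M : IncomeFluctuation Z E F) (b : ℝ≥0) (w : Z × E × F) : ℝ≥0 :=
  M.ret w * b + M.inc w

/-- The state `(a_t, z_t)` under the policy `c`, started at `(a, z)`. -/
def statePath (M : IncomeFluctuation Z E F) (c : ℝ≥0 × Z → ℝ≥0) (a : ℝ≥0) (z : Z)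
    (ω : ℕ → Z × E × F) : ℕ → ℝ≥0 × Z
  | 0 => (a, z)
  | t + 1 =>
    (M.nextWealth ((M.statePath c a z ω t).1 - c (M.statePath c a z ω t)) (ω t), (ω t).1)

/-- Lifetime value `V_c(a, z) = 𝔼_{a,z} ∑_t β ^ t u(c(a_t, z_t))`, as the expected discounted sum
of the positive parts minus that of the negative parts. -/
def lifetimeValue (M : IncomeFluctuation Z E F) (c : ℝ≥0 × Z → ℝ≥0) (a : ℝ≥0) (z : Z) : EReal :=
  ((∫⁻ ω, ∑' t : ℕ, (M.β : ℝ≥0∞) ^ t * (M.u (c (M.statePath c a z ω t))).toENNReal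
      ∂M.pathLaw : ℝ≥0∞) : EReal) -
  ((∫⁻ ω, ∑' t : ℕ, (M.β : ℝ≥0∞) ^ t * (-M.u (c (M.statePath c a z ω t))).toENNReal
      ∂M.pathLaw : ℝ≥0∞) : EReal)

/-- A feasible policy is optimal if no feasible policy has a larger lifetime value at any
`(a, z)` with `a > 0`. -/
def Optimal (M : IncomeFluctuation Z E F) (c : ℝ≥0 × Z → ℝ≥0) : Prop :=
  Feasible c ∧ ∀ d : ℝ≥0 × Z → ℝ≥0, Feasible d →
    ∀ (a : ℝ≥0) (z : Z), 0 < a → M.lifetimeValue d a z ≤ M.lifetimeValue c a z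

/-- The kernel of the wealth process `a_{t+1} = R_{t+1} (a_t - c(a_t)) + Y_{t+1}` on `[0, ∞)`:
`Q(a, ·)` is the law of `R (a - c(a)) + Y`, for measurable `c`. -/
def wealthKernel (M : IncomeFluctuation Z E F) (c : ℝ≥0 → ℝ≥0) : Kernel ℝ≥0 ℝ≥0 :=
  (Kernel.id ×ₖ Kernel.const ℝ≥0 M.shock).map fun p => M.nextWealth (p.1 - c p.1) p.2

end

end IncomeFluctuation

/-- Global stability of a kernel `Q`: it has a unique stationary distribution `ψ`, and `ψ₀ Q ^ t`
converges weakly to `ψ` for every initial distribution `ψ₀`. Powers of kernels are those of the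
composition monoid. -/
def GloballyStable {S : Type*} [TopologicalSpace S] [MeasurableSpace S] (Q : Kernel S S) : Prop :=
  ∃ ψ : Measure S, IsProbabilityMeasure ψ ∧ ψ.bind Q = ψ ∧
    (∀ φ : Measure S, IsProbabilityMeasure φ → φ.bind Q = φ → φ = ψ) ∧
    ∀ ψ₀ : Measure S, IsProbabilityMeasure ψ₀ → ∀ h : S →ᵇ ℝ,
      Tendsto (fun t : ℕ => ∫ x, h x ∂(ψ₀.bind (Q ^ t : Kernel S S))) atTop (𝓝 (∫ x, h x ∂ψ))

/-!
Time iteration started from consuming everything decreases to a concave solution `c` of the Euler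
equation that consumes at least the fraction `α` of wealth. For this `c` the tangent inequality for
`u` and the Euler equation show that expected utility to date plus the shadow value of current
wealth can only fall when consumption departs from `c`; the discounted shadow values are summable,
so no terminal term survives and `c` beats every feasible policy, strictly where they differ.

Concavity together with `α a ≤ c a` makes `a ↦ a - c a` Lipschitz with constant `1 - α`. Wealth is
then an iteration of random Lipschitz maps that contract on average, whose backward iterates
converge almost surely, and the law of their limit is the globally attracting stationary law.
-/

section ExtendedReals

lemma exists_nnreal_add_mul_le {a θ : ℝ≥0∞} (ha : a ≠ ⊤) (hθ : θ < 1) :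
    ∃ κ : ℝ≥0, a + θ * κ ≤ κ := by
  lift θ to ℝ≥0 using hθ.ne_top
  lift a to ℝ≥0 using ha
  have hθ' : θ < 1 := by exact_mod_cast hθ
  refine ⟨a / (1 - θ), ?_⟩
  norm_cast
  calc a + θ * (a / (1 - θ)) = (1 - θ) * (a / (1 - θ)) + θ * (a / (1 - θ)) := by
        rw [mul_div_cancel₀ _ (tsub_pos_of_lt hθ').ne']
    _ ≤ a / (1 - θ) := by rw [← add_mul, tsub_add_cancel_of_le hθ'.le, one_mul]

lemma coe_ennreal_sub_le_sub {p n p' n' : ℝ≥0∞} (hn' : n' ≠ ⊤) (h : p + n' ≤ p' + n) :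
    (p : EReal) - n ≤ (p' : EReal) - n' := by
  rw [EReal.le_sub_iff_add_le (.inl (EReal.coe_ennreal_ne_bot n'))
    (.inl (EReal.coe_ennreal_eq_top_iff.not.2 hn')), sub_eq_add_neg, add_right_comm,
    ← sub_eq_add_neg]
  exact EReal.sub_le_of_le_add (by exact_mod_cast h)

lemma coe_ennreal_sub_lt_sub {p n p' n' : ℝ≥0∞} (hn' : n' ≠ ⊤) (h : p + n' < p' + n) :
    (p : EReal) - n < (p' : EReal) - n' := by
  rw [EReal.lt_sub_iff_add_lt (.inl (EReal.coe_ennreal_ne_bot n'))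
    (.inl (EReal.coe_ennreal_eq_top_iff.not.2 hn')), sub_eq_add_neg, add_right_comm,
    ← sub_eq_add_neg]
  exact EReal.sub_lt_of_lt_add (by exact_mod_cast h)

lemma toENNReal_add_toENNReal_neg_add_lt {x y p q : ℝ} (hp : 0 ≤ p) (hq : 0 ≤ q)
    (h : x + p < y + q) :
    (x : EReal).toENNReal + (-(y : EReal)).toENNReal + ENNReal.ofReal p
      < (y : EReal).toENNReal + (-(x : EReal)).toENNReal + ENNReal.ofReal q := by
  have hofReal (r : ℝ) : ENNReal.ofReal r = ENNReal.ofReal (max r 0) := by simp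
  have hmax (r : ℝ) : max r 0 - max (-r) 0 = r := max_zero_sub_max_neg_zero_eq_self r
  simp only [← EReal.coe_neg, EReal.real_coe_toENNReal]
  rw [hofReal x, hofReal (-x), hofReal y, hofReal (-y)]
  repeat rw [← ENNReal.ofReal_add (by positivity) (by positivity)]
  have hlt : max x 0 + max (-y) 0 + p < max y 0 + max (-x) 0 + q := by
    linarith [hmax x, hmax y]
  exact (ENNReal.ofReal_lt_ofReal_iff ((by positivity : (0 : ℝ) ≤ _).trans_lt hlt)).2 hlt

end ExtendedReals

section DiscountedSums

variable {β : ℝ≥0∞} {f g k x y : ℕ → ℝ≥0∞} {A B : ℝ≥0∞}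

lemma tsum_pow_ne_top (hβ : β < 1) : ∑' t, β ^ t ≠ ⊤ := by
  rw [ENNReal.tsum_geometric]
  exact ENNReal.inv_ne_top.2 (tsub_pos_of_lt hβ).ne'

lemma tsum_pow_mul_ne_top_of_le (hβ : β < 1) (hA : A ≠ ⊤) (hB : B ≠ ⊤)
    (hg : ∑' t, β ^ t * g t ≠ ⊤) (hfg : ∀ t, f t ≤ A * g t + B) : ∑' t, β ^ t * f t ≠ ⊤ := by
  have hle : ∑' t, β ^ t * f t ≤ A * ∑' t, β ^ t * g t + B * ∑' t, β ^ t := by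
    rw [← ENNReal.tsum_mul_left, ← ENNReal.tsum_mul_left, ← ENNReal.tsum_add]
    refine ENNReal.tsum_le_tsum fun t => ?_
    calc β ^ t * f t ≤ β ^ t * (A * g t + B) := by gcongr; exact hfg t
      _ = A * (β ^ t * g t) + B * β ^ t := by ring
  exact ne_top_of_le_ne_top (ENNReal.add_ne_top.2
    ⟨ENNReal.mul_ne_top hA hg, ENNReal.mul_ne_top hB (tsum_pow_ne_top hβ)⟩) hle

lemma tsum_pow_mul_ne_top_of_succ_le (hβ : β < 1) (hA : A ≠ ⊤) (hB : B ≠ ⊤)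
    (hg : ∑' t, β ^ t * g t ≠ ⊤) (hf₀ : f 0 ≠ ⊤) (hfg : ∀ t, f (t + 1) ≤ A * g t + B) :
    ∑' t, β ^ t * f t ≠ ⊤ := by
  rw [tsum_eq_zero_add' ENNReal.summable]
  refine ENNReal.add_ne_top.2 ⟨by simpa using hf₀, ?_⟩
  simp only [pow_succ', mul_assoc]
  rw [ENNReal.tsum_mul_left]
  exact ENNReal.mul_ne_top hβ.ne_top (tsum_pow_mul_ne_top_of_le hβ hA hB hg hfg)

lemma tsum_pow_mul_ne_top_of_recursion (hβ : β < 1) (hA : β * A < 1) (hB : B ≠ ⊤)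
    (hx₀ : x 0 ≠ ⊤) (hx : ∀ t, x (t + 1) ≤ A * x t + B) : ∑' t, β ^ t * x t ≠ ⊤ := by
  obtain ⟨κ, hκ⟩ := exists_nnreal_add_mul_le (a := x 0 + β * B * ∑' t, β ^ t)
    (ENNReal.add_ne_top.2 ⟨hx₀, ENNReal.mul_ne_top (ENNReal.mul_ne_top hβ.ne_top hB)
      (tsum_pow_ne_top hβ)⟩) hA
  refine ne_top_of_le_ne_top (ENNReal.coe_ne_top (r := κ))
    (ENNReal.tsum_le_of_sum_range_le fun T => ?_)
  induction T with
  | zero => simp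
  | succ T ih =>
    calc ∑ t ∈ Finset.range (T + 1), β ^ t * x t
        = x 0 + ∑ t ∈ Finset.range T, β ^ (t + 1) * x (t + 1) := by
          rw [Finset.sum_range_succ', pow_zero, one_mul, add_comm]
      _ ≤ x 0 + ∑ t ∈ Finset.range T, (β * B * β ^ t + β * A * (β ^ t * x t)) := by
          gcongr with t
          calc β ^ (t + 1) * x (t + 1) ≤ β ^ (t + 1) * (A * x t + B) := by gcongr; exact hx t
            _ = β * B * β ^ t + β * A * (β ^ t * x t) := by ring
      _ = x 0 + β * B * ∑ t ∈ Finset.range T, β ^ t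
          + β * A * ∑ t ∈ Finset.range T, β ^ t * x t := by
          rw [Finset.sum_add_distrib, Finset.mul_sum, Finset.mul_sum, add_assoc]
      _ ≤ x 0 + β * B * ∑' t, β ^ t + β * A * κ := by
          gcongr
          exact ENNReal.sum_le_tsum _
      _ ≤ κ := hκ

lemma sum_range_pow_mul_add_le_of_telescope
    (hstep : ∀ t, g t + β * x (t + 1) + y t ≤ k t + x t + β * y (t + 1))
    (hx : ∀ t, β ^ t * x t ≠ ⊤) (hy : ∀ t, β ^ t * y t ≠ ⊤) (T : ℕ) :
    ∑ t ∈ Finset.range T, β ^ t * g t + β ^ T * x T + y 0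
      ≤ ∑ t ∈ Finset.range T, β ^ t * k t + x 0 + β ^ T * y T := by
  induction T with
  | zero => simp
  | succ T ih =>
    rw [Finset.sum_range_succ, Finset.sum_range_succ]
    refine (ENNReal.add_le_add_iff_right (ENNReal.add_ne_top.2 ⟨hx T, hy T⟩)).1 ?_
    calc _ = (∑ t ∈ Finset.range T, β ^ t * g t + β ^ T * x T + y 0)
          + β ^ T * (g T + β * x (T + 1) + y T) := by ring
      _ ≤ (∑ t ∈ Finset.range T, β ^ t * k t + x 0 + β ^ T * y T)
          + β ^ T * (k T + x T + β * y (T + 1)) :=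
          add_le_add ih (mul_le_mul_right (hstep T) _)
      _ = _ := by ring

lemma tsum_pow_mul_le_of_telescope
    (hstep : ∀ t, g t + β * x (t + 1) + y t ≤ k t + x t + β * y (t + 1)) (hxy : x 0 = y 0)
    (hx : ∑' t, β ^ t * x t ≠ ⊤) (hy : ∑' t, β ^ t * y t ≠ ⊤) :
    ∑' t, β ^ t * g t ≤ ∑' t, β ^ t * k t := by
  have hx_fin := ENNReal.ne_top_of_tsum_ne_top hx
  have hy_fin := ENNReal.ne_top_of_tsum_ne_top hy
  have hpartial (T : ℕ) :
      ∑ t ∈ Finset.range T, β ^ t * g t ≤ ∑' t, β ^ t * k t + β ^ T * y T := by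
    refine (ENNReal.add_le_add_iff_right (by simpa using hy_fin 0)).1 ?_
    calc ∑ t ∈ Finset.range T, β ^ t * g t + y 0
        ≤ ∑ t ∈ Finset.range T, β ^ t * g t + β ^ T * x T + y 0 := by gcongr; exact le_self_add
      _ ≤ ∑ t ∈ Finset.range T, β ^ t * k t + x 0 + β ^ T * y T :=
          sum_range_pow_mul_add_le_of_telescope hstep hx_fin hy_fin T
      _ ≤ ∑' t, β ^ t * k t + x 0 + β ^ T * y T := by gcongr; exact ENNReal.sum_le_tsum _
      _ = ∑' t, β ^ t * k t + β ^ T * y T + y 0 := by rw [hxy, add_right_comm]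
  have hlim : Tendsto (fun T => ∑' t, β ^ t * k t + β ^ T * y T) atTop
      (𝓝 (∑' t, β ^ t * k t + 0)) :=
    tendsto_const_nhds.add (ENNReal.tendsto_atTop_zero_of_tsum_ne_top hy)
  rw [add_zero] at hlim
  exact le_of_tendsto_of_tendsto' (ENNReal.tendsto_nat_tsum _) hlim hpartial

lemma tsum_pow_mul_lt_of_telescope
    (hstep : ∀ t, g t + β * x (t + 1) + y t ≤ k t + x t + β * y (t + 1)) (hxy : x 0 = y 0)
    (hx : ∑' t, β ^ t * x t ≠ ⊤) (hy : ∑' t, β ^ t * y t ≠ ⊤) (hg : ∑' t, β ^ t * g t ≠ ⊤)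
    (hlt : g 0 + β * x 1 + y 0 < k 0 + x 0 + β * y 1) :
    ∑' t, β ^ t * g t < ∑' t, β ^ t * k t := by
  obtain ⟨slack, hslack_pos, hslack⟩ :
      ∃ s : ℝ≥0∞, 0 < s ∧ g 0 + β * x 1 + y 0 + s = k 0 + x 0 + β * y 1 :=
    ⟨_, tsub_pos_of_lt hlt, add_tsub_cancel_of_le hlt.le⟩
  have hstep' (t : ℕ) : g t + (Pi.single 0 slack : ℕ → ℝ≥0∞) t + β * x (t + 1) + y t
      ≤ k t + x t + β * y (t + 1) := by
    rcases eq_or_ne t 0 with rfl | ht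
    · rw [Pi.single_eq_same, add_right_comm (g 0), add_right_comm _ slack, zero_add, hslack]
    · simpa [ht] using hstep t
  have hle := tsum_pow_mul_le_of_telescope hstep' hxy hx hy
  simp only [mul_add, ENNReal.tsum_add] at hle
  refine (ENNReal.lt_add_right hg hslack_pos.ne').trans_le (le_trans ?_ hle)
  gcongr
  simpa using ENNReal.le_tsum (f := fun t => β ^ t * (Pi.single 0 slack : ℕ → ℝ≥0∞) t) 0

end DiscountedSums

section Concave

lemma concaveOn_coe_toNNReal {c : ℝ≥0 → ℝ≥0} (hc : ConcaveOn ℝ≥0 (Ioi 0) c) :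
    ConcaveOn ℝ (Ioi 0) fun a : ℝ => (c a.toNNReal : ℝ) := by
  refine ⟨convex_Ioi 0, fun a ha b hb p q hp hq hpq => ?_⟩
  have ha' := Real.toNNReal_pos.2 ha
  have hb' := Real.toNNReal_pos.2 hb
  lift a to ℝ≥0 using (mem_Ioi.1 ha).le
  lift b to ℝ≥0 using (mem_Ioi.1 hb).le
  lift p to ℝ≥0 using hp
  lift q to ℝ≥0 using hq
  rw [Real.toNNReal_coe] at ha' hb'
  have hle := hc.2 ha' hb' (zero_le (a := p)) (zero_le (a := q)) (by exact_mod_cast hpq)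
  simp only [smul_eq_mul, ← NNReal.coe_mul, ← NNReal.coe_add, Real.toNNReal_coe] at hle ⊢
  exact_mod_cast hle

variable {f : ℝ → ℝ}

lemma monotoneOn_Ioi_of_concaveOn_of_le {a b : ℝ} (hf : ConcaveOn ℝ (Ioi a) f)
    (hb : ∀ x ∈ Ioi a, b ≤ f x) : MonotoneOn f (Ioi a) := by
  intro x hx y hy hxy
  by_contra! hlt
  have hxy' : x < y := hxy.lt_of_ne fun h => hlt.ne (h ▸ rfl)
  set s := (f x - f y) / (y - x) with hs
  have hs_pos : 0 < s := div_pos (sub_pos.2 hlt) (sub_pos.2 hxy')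
  set z := y + ((f y - b) / s + 1) with hz
  have hyz : y < z := lt_add_of_pos_right y
    (add_pos_of_nonneg_of_pos (div_nonneg (sub_nonneg.2 (hb y hy)) hs_pos.le) one_pos)
  have hslope : (f z - f y) / (z - y) ≤ -s := by
    rw [hs, ← neg_div, neg_sub]
    exact hf.slope_anti_adjacent hx (hy.trans hyz) hxy' hyz
  have hdrop : s * (z - y) = f y - b + s := by
    rw [hz]
    field_simp
    ring
  rw [div_le_iff₀ (sub_pos.2 hyz)] at hslope
  linarith [hb z (hy.trans hyz)]

lemma lt_tangent_of_strictConcaveOn {D : Set ℝ} {x y : ℝ} (hf : StrictConcaveOn ℝ D f)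
    (hx : x ∈ D) (hy : y ∈ D) (hyx : y ≠ x) (hfx : DifferentiableAt ℝ f x) :
    f y < f x + deriv f x * (y - x) := by
  rcases hyx.lt_or_gt with hlt | hlt
  · have hslope := hf.deriv_lt_slope hy hx hlt hfx
    rw [slope_def_field, lt_div_iff₀ (sub_pos.2 hlt)] at hslope
    linarith
  · have hslope := hf.slope_lt_deriv hx hy hlt hfx
    rw [slope_def_field, div_lt_iff₀ (sub_pos.2 hlt)] at hslope
    linarith

lemma lt_tangent_left_of_strictConcaveOn_Ioi {a b x : ℝ} (hf : StrictConcaveOn ℝ (Ioi a) f)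
    (hb : ∀ y ∈ Ioi a, b ≤ f y) (hx : x ∈ Ioi a) (hfx : DifferentiableAt ℝ f x) :
    b < f x + deriv f x * (a - x) := by
  set m := (a + x) / 2 with hm
  have ham : a < m := by linarith [mem_Ioi.1 hx]
  have hmx : m < x := by linarith [mem_Ioi.1 hx]
  have htangent := lt_tangent_of_strictConcaveOn hf hx ham hmx.ne hfx
  have hslope_m := hf.deriv_lt_slope ham hx hmx hfx
  rw [slope_def_field] at hslope_m
  have hbound : ∀ y ∈ Ioo a m, b ≤ f m + deriv f x * (y - m) := by
    rintro y ⟨hay, hym⟩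
    have hslope_y := hslope_m.trans (hf.slope_anti_adjacent hay hx hym hmx)
    rw [lt_div_iff₀ (sub_pos.2 hym)] at hslope_y
    linarith [hb y hay]
  have hlim : Tendsto (fun y => f m + deriv f x * (y - m)) (𝓝[>] a)
      (𝓝 (f m + deriv f x * (a - m))) :=
    (Continuous.tendsto (by fun_prop) a).mono_left nhdsWithin_le_nhds
  have hb_le := ge_of_tendsto hlim (eventually_of_mem (Ioo_mem_nhdsGT ham) hbound)
  linarith

end Concave

section ProductMeasure

variable {ι : Type*} {X : ι → Type*} [∀ i, MeasurableSpace (X i)]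
  {μ : ∀ i, Measure (X i)} [∀ i, IsProbabilityMeasure (μ i)]

lemma map_update_infinitePi_prod [DecidableEq ι] (i : ι) :
    ((Measure.infinitePi μ).prod (μ i)).map (fun p => Function.update p.1 i p.2)
      = Measure.infinitePi μ := by
  refine Measure.eq_infinitePi _ fun s t ht => ?_
  have hpre : (fun p : (∀ j, X j) × X i => Function.update p.1 i p.2) ⁻¹' (s : Set ι).pi t
      = (s.erase i : Set ι).pi t ×ˢ (if i ∈ s then t i else univ) := by
    ext ⟨ω, x⟩
    constructor
    · refine fun h => ⟨fun j hj => ?_, ?_⟩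
      · simpa [Finset.ne_of_mem_erase hj] using h j (Finset.mem_of_mem_erase hj)
      · split_ifs with hi
        · simpa using h i hi
        · trivial
    · rintro ⟨hω, hx⟩ j hj
      rcases eq_or_ne j i with rfl | hji
      · simpa [show j ∈ s from hj] using hx
      · simpa [hji] using hω j (Finset.mem_erase.2 ⟨hji, hj⟩)
  rw [Measure.map_apply (by fun_prop) (.pi s.countable_toSet fun j _ => ht j), hpre,
    Measure.prod_prod, Measure.infinitePi_pi _ fun j _ => ht j]
  split_ifs with hi
  · exact Finset.prod_erase_mul s (fun j => μ j (t j)) hi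
  · rw [Finset.erase_eq_of_notMem hi, measure_univ, mul_one]

lemma lintegral_infinitePi_eval {i : ι} {f : X i → ℝ≥0∞} (hf : Measurable f) :
    ∫⁻ ω, f (ω i) ∂Measure.infinitePi μ = ∫⁻ x, f x ∂μ i :=
  (measurePreserving_eval_infinitePi μ i).lintegral_comp hf

lemma lintegral_infinitePi_eval_of_dependsOn {i : ι} {G : (∀ j, X j) → X i → ℝ≥0∞}
    (hG : Measurable (Function.uncurry G)) (hdep : ∀ x, DependsOn (fun ω => G ω x) {i}ᶜ) :
    ∫⁻ ω, G ω (ω i) ∂Measure.infinitePi μ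
      = ∫⁻ ω, ∫⁻ x, G ω x ∂μ i ∂Measure.infinitePi μ := by
  classical
  have hupdate : ∀ (ω : ∀ j, X j) (x : X i),
      G (Function.update ω i x) (Function.update ω i x i) = G ω x := fun ω x => by
    rw [Function.update_self]
    exact hdep x fun j hj => Function.update_of_ne hj _ _
  have hdiag : Measurable fun ω => G ω (ω i) :=
    hG.comp (measurable_id.prodMk (measurable_pi_apply i))
  conv_lhs => rw [← map_update_infinitePi_prod i]
  rw [lintegral_map hdiag (by fun_prop)]
  simp only [hupdate]
  exact lintegral_prod _ hG.aemeasurable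

lemma lintegral_infinitePi_prod (s : Finset ι) {f : ∀ i, X i → ℝ≥0∞}
    (hf : ∀ i, Measurable (f i)) :
    ∫⁻ ω, ∏ i ∈ s, f i (ω i) ∂Measure.infinitePi μ = ∏ i ∈ s, ∫⁻ x, f i x ∂μ i := by
  rw [lintegral_prod_eq_prod_lintegral_of_indepFun s (fun i (ω : ∀ j, X j) => f i (ω i))
    (iIndepFun_infinitePi hf) (by fun_prop)]
  exact Finset.prod_congr rfl fun i _ => lintegral_infinitePi_eval (hf i)

end ProductMeasure

section FellerKernel

variable {S : Type*} [MeasurableSpace S] {Q : Kernel S S}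

lemma bind_pow_eq_of_bind_eq {φ : Measure S} (hφ : φ.bind Q = φ) (t : ℕ) :
    φ.bind (Q ^ t : Kernel S S) = φ := by
  induction t with
  | zero => exact Measure.bind_dirac
  | succ t ih =>
    calc φ.bind (Q ^ (t + 1) : Kernel S S) = (φ.bind Q).bind (Q ^ t : Kernel S S) :=
        Measure.comp_assoc.symm
      _ = φ := by rw [hφ, ih]

variable [IsMarkovKernel Q]

instance isMarkovKernel_pow (t : ℕ) : IsMarkovKernel (Q ^ t : Kernel S S) := by
  induction t with
  | zero => exact inferInstanceAs (IsMarkovKernel Kernel.id)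
  | succ t ih => exact inferInstanceAs (IsMarkovKernel ((Q ^ t : Kernel S S) ∘ₖ Q))

variable [TopologicalSpace S] [BorelSpace S]

lemma integral_bind_boundedContinuous (μ : Measure S) [IsProbabilityMeasure μ] (h : S →ᵇ ℝ) :
    ∫ y, h y ∂μ.bind Q = ∫ x, ∫ y, h y ∂Q x ∂μ :=
  Kernel.integral_comp (κ := Kernel.const Unit μ) (a := ()) (h.integrable (μ.bind Q))

lemma tendsto_integral_bind_pow {ψ : Measure S}
    (hlim : ∀ (x : S) (h : S →ᵇ ℝ), Tendsto (fun t : ℕ => ∫ y, h y ∂(Q ^ t : Kernel S S) x) atTop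
      (𝓝 (∫ y, h y ∂ψ)))
    (ψ₀ : Measure S) [IsProbabilityMeasure ψ₀] (h : S →ᵇ ℝ) :
    Tendsto (fun t : ℕ => ∫ y, h y ∂ψ₀.bind (Q ^ t : Kernel S S)) atTop (𝓝 (∫ y, h y ∂ψ)) := by
  simp only [integral_bind_boundedContinuous]
  have hconst : ∫ y, h y ∂ψ = ∫ _, ∫ y, h y ∂ψ ∂ψ₀ := by simp
  rw [hconst]
  refine tendsto_integral_of_dominated_convergence (fun _ => ‖h‖) (fun t => ?_)
    (integrable_const _) (fun t => ae_of_all _ fun x => h.norm_integral_le_norm _)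
    (ae_of_all _ fun x => hlim x h)
  exact (h.continuous.measurable.stronglyMeasurable.integral_kernel).aestronglyMeasurable

theorem globallyStable_of_feller [HasOuterApproxClosed S] {ψ : Measure S} [IsProbabilityMeasure ψ]
    (hfeller : ∀ h : S →ᵇ ℝ, Continuous fun x => ∫ y, h y ∂Q x)
    (hlim : ∀ (x : S) (h : S →ᵇ ℝ), Tendsto (fun t : ℕ => ∫ y, h y ∂(Q ^ t : Kernel S S) x) atTop
      (𝓝 (∫ y, h y ∂ψ))) :
    GloballyStable Q := by
  refine ⟨ψ, inferInstance, ?_, fun φ _ hφ => ?_, fun ψ₀ _ => tendsto_integral_bind_pow hlim ψ₀⟩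
  · refine ext_of_forall_integral_eq_of_IsFiniteMeasure fun h => ?_
    let Qh : S →ᵇ ℝ := BoundedContinuousFunction.ofNormedAddCommGroup _ (hfeller h) ‖h‖
      fun x => h.norm_integral_le_norm _
    obtain ⟨x⟩ : Nonempty S := ψ.nonempty_of_neZero
    have hstep (t : ℕ) : ∫ y, Qh y ∂(Q ^ t : Kernel S S) x
        = ∫ y, h y ∂(Q ^ (t + 1) : Kernel S S) x := by
      rw [pow_succ']
      exact (integral_bind_boundedContinuous ((Q ^ t : Kernel S S) x) h).symm
    rw [integral_bind_boundedContinuous]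
    exact tendsto_nhds_unique (hlim x Qh)
      (((hlim x h).comp (tendsto_add_atTop_nat 1)).congr fun t => (hstep t).symm)
  · refine ext_of_forall_integral_eq_of_IsFiniteMeasure fun h => ?_
    have hconv := tendsto_integral_bind_pow hlim φ h
    simp only [bind_pow_eq_of_bind_eq hφ] at hconv
    exact tendsto_nhds_unique tendsto_const_nhds hconv

end FellerKernel

section RandomMaps

variable {S W : Type*} {Φ : W → S → S}

/-- The maps drawn in the periods `0, …, t - 1`, composed with the most recent one innermost:
`Φ (ω 0) ∘ ⋯ ∘ Φ (ω (t - 1))`. At each fixed `t` it has the law of the `t`-step chain, but unlike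
the chain it converges pathwise. -/
def backwardIterate (Φ : W → S → S) (ω : ℕ → W) : ℕ → S → S
  | 0 => id
  | t + 1 => backwardIterate Φ ω t ∘ Φ (ω t)

lemma dependsOn_backwardIterate (Φ : W → S → S) (t : ℕ) (x : S) :
    DependsOn (fun ω => backwardIterate Φ ω t x) (Iio t) := by
  induction t generalizing x with
  | zero => exact fun _ _ _ => rfl
  | succ t ih =>
    intro ω ω' h
    simp only [backwardIterate, Function.comp_apply, h t (lt_add_one t)]
    exact ih _ fun i hi => h i (Nat.lt_succ_of_lt hi)

lemma lipschitzWith_backwardIterate [PseudoEMetricSpace S] {L : W → ℝ≥0}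
    (hΦL : ∀ w, LipschitzWith (L w) (Φ w)) (ω : ℕ → W) (t : ℕ) :
    LipschitzWith (∏ i ∈ Finset.range t, L (ω i)) (backwardIterate Φ ω t) := by
  induction t with
  | zero => simpa [backwardIterate] using LipschitzWith.id
  | succ t ih =>
    rw [Finset.prod_range_succ]
    exact ih.comp (hΦL (ω t))

variable [MeasurableSpace S] [MeasurableSpace W]

lemma measurable_backwardIterate (hΦ : Measurable (Function.uncurry Φ)) (t : ℕ) :
    Measurable fun p : (ℕ → W) × S => backwardIterate Φ p.1 t p.2 := by
  induction t with
  | zero => exact measurable_snd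
  | succ t ih =>
    exact ih.comp (measurable_fst.prodMk
      (hΦ.comp (((measurable_pi_apply t).comp measurable_fst).prodMk measurable_snd)))

/-- The transition kernel of the Markov chain `x_{t+1} = Φ w_{t+1} x_t` driven by iid shocks `w_t`
with law `μ`. -/
noncomputable def randomMapKernel (μ : Measure W) (Φ : W → S → S) : Kernel S S :=
  (Kernel.id ×ₖ Kernel.const S μ).map fun p => Φ p.2 p.1

variable {μ : Measure W}

lemma randomMapKernel_apply [SFinite μ] (hΦ : Measurable (Function.uncurry Φ)) (x : S) :
    randomMapKernel μ Φ x = μ.map fun w => Φ w x := by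
  have hm : Measurable fun p : S × W => Φ p.2 p.1 := hΦ.comp measurable_swap
  rw [randomMapKernel, Kernel.map_apply _ hm, Kernel.prod_apply, Kernel.id_apply,
    Kernel.const_apply, Measure.dirac_prod, Measure.map_map hm (by fun_prop)]
  rfl

variable [IsProbabilityMeasure μ]

lemma isMarkovKernel_randomMapKernel (hΦ : Measurable (Function.uncurry Φ)) :
    IsMarkovKernel (randomMapKernel μ Φ) :=
  Kernel.IsMarkovKernel.map _ (hΦ.comp measurable_swap)

lemma randomMapKernel_pow_apply (hΦ : Measurable (Function.uncurry Φ)) (t : ℕ) (x : S) :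
    (randomMapKernel μ Φ ^ t : Kernel S S) x
      = (Measure.infinitePi fun _ : ℕ => μ).map fun ω => backwardIterate Φ ω t x := by
  have hB (t : ℕ) (x : S) : Measurable fun ω => backwardIterate Φ ω t x :=
    (measurable_backwardIterate hΦ t).comp measurable_prodMk_right
  have hΦx (x : S) : Measurable fun w => Φ w x := hΦ.comp measurable_prodMk_right
  induction t generalizing x with
  | zero =>
    simp only [pow_zero, backwardIterate, id_eq, Measure.map_const, measure_univ, one_smul]
    exact Kernel.id_apply x
  | succ t ih =>
    refine Measure.ext_of_lintegral _ fun h hh => ?_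
    have hG : Measurable fun p : (ℕ → W) × W => h (backwardIterate Φ p.1 t (Φ p.2 x)) :=
      hh.comp ((measurable_backwardIterate hΦ t).comp
        (measurable_fst.prodMk ((hΦx x).comp measurable_snd)))
    calc ∫⁻ y, h y ∂(randomMapKernel μ Φ ^ (t + 1) : Kernel S S) x
        = ∫⁻ w, ∫⁻ y, h y ∂(randomMapKernel μ Φ ^ t : Kernel S S) (Φ w x) ∂μ := by
          rw [pow_succ, show randomMapKernel μ Φ ^ t * randomMapKernel μ Φ
              = (randomMapKernel μ Φ ^ t : Kernel S S) ∘ₖ randomMapKernel μ Φ from rfl,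
            Kernel.lintegral_comp _ _ _ hh, randomMapKernel_apply hΦ,
            lintegral_map hh.lintegral_kernel (hΦx x)]
      _ = ∫⁻ w, ∫⁻ ω, h (backwardIterate Φ ω t (Φ w x)) ∂(Measure.infinitePi fun _ => μ) ∂μ :=
          lintegral_congr fun w => by rw [ih, lintegral_map hh (hB t _)]
      _ = ∫⁻ ω, ∫⁻ w, h (backwardIterate Φ ω t (Φ w x)) ∂μ ∂(Measure.infinitePi fun _ => μ) :=
          (lintegral_lintegral_swap hG.aemeasurable).symm
      _ = ∫⁻ ω, h (backwardIterate Φ ω (t + 1) x) ∂(Measure.infinitePi fun _ => μ) :=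
          (lintegral_infinitePi_eval_of_dependsOn (i := t)
            (G := fun ω w => h (backwardIterate Φ ω t (Φ w x))) hG fun w ω ω' hω => congrArg h
              (dependsOn_backwardIterate Φ t _ fun i hi => hω i (ne_of_lt hi))).symm
      _ = _ := (lintegral_map hh (hB _ x)).symm

end RandomMaps

section RandomLipschitzMaps

variable {S W : Type*} [MeasurableSpace W] {μ : Measure W} [IsProbabilityMeasure μ]

section Products

variable {L g : W → ℝ≥0∞}

lemma lintegral_prod_range_mul (hL : Measurable L) (hg : Measurable g) (t : ℕ) :
    ∫⁻ ω, (∏ i ∈ Finset.range t, L (ω i)) * g (ω t) ∂(Measure.infinitePi fun _ : ℕ => μ)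
      = (∫⁻ w, L w ∂μ) ^ t * ∫⁻ w, g w ∂μ := by
  have hprod : Measurable fun ω : ℕ → W => ∏ i ∈ Finset.range t, L (ω i) := by fun_prop
  rw [lintegral_infinitePi_eval_of_dependsOn (i := t)
    (G := fun ω w => (∏ i ∈ Finset.range t, L (ω i)) * g w) (by fun_prop)]
  · simp only [lintegral_const_mul _ hg]
    rw [lintegral_mul_const _ hprod, lintegral_infinitePi_prod _ fun _ => hL, Finset.prod_const,
      Finset.card_range]
  · intro w ω ω' h
    refine congrArg (· * g w) (Finset.prod_congr rfl fun i hi => ?_)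
    rw [h i (Finset.mem_range.1 hi).ne]

lemma ae_tsum_prod_range_mul_lt_top (hL : Measurable L) (hL₁ : ∫⁻ w, L w ∂μ < 1)
    (hg : Measurable g) (hg_top : ∫⁻ w, g w ∂μ ≠ ⊤) :
    ∀ᵐ ω ∂(Measure.infinitePi fun _ : ℕ => μ),
      ∑' t, (∏ i ∈ Finset.range t, L (ω i)) * g (ω t) < ⊤ := by
  have hmeas (t : ℕ) : Measurable fun ω : ℕ → W => (∏ i ∈ Finset.range t, L (ω i)) * g (ω t) := by
    fun_prop
  refine ae_lt_top (Measurable.tsum hmeas) ?_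
  rw [lintegral_tsum fun t => (hmeas t).aemeasurable]
  simp only [lintegral_prod_range_mul hL hg]
  rw [ENNReal.tsum_mul_right, ENNReal.tsum_geometric]
  exact ENNReal.mul_ne_top (ENNReal.inv_ne_top.2 (tsub_pos_of_lt hL₁).ne') hg_top

lemma ae_tendsto_prod_range_zero (hL : Measurable L) (hL₁ : ∫⁻ w, L w ∂μ < 1) :
    ∀ᵐ ω ∂(Measure.infinitePi fun _ : ℕ => μ),
      Tendsto (fun t => ∏ i ∈ Finset.range t, L (ω i)) atTop (𝓝 0) := by
  filter_upwards [ae_tsum_prod_range_mul_lt_top hL hL₁ measurable_const (g := 1) (by simp)]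
    with ω hω
  simpa using ENNReal.tendsto_atTop_zero_of_tsum_ne_top hω.ne

end Products

variable [PseudoMetricSpace S] [MeasurableSpace S] [BorelSpace S] {Φ : W → S → S} {L : W → ℝ≥0}
  {x₀ : S}

lemma ae_exists_tendsto_backwardIterate [CompleteSpace S] (hΦ : Measurable (Function.uncurry Φ))
    (hΦL : ∀ w, LipschitzWith (L w) (Φ w)) (hL : Measurable L) (hL₁ : ∫⁻ w, L w ∂μ < 1)
    (hx₀ : ∫⁻ w, edist x₀ (Φ w x₀) ∂μ ≠ ⊤) :
    ∀ᵐ ω ∂(Measure.infinitePi fun _ : ℕ => μ),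
      ∃ l, Tendsto (fun t => backwardIterate Φ ω t x₀) atTop (𝓝 l) := by
  have hdist : Measurable fun w => edist x₀ (Φ w x₀) :=
    (continuous_const.edist continuous_id).measurable.comp (hΦ.comp measurable_prodMk_right)
  filter_upwards [ae_tsum_prod_range_mul_lt_top hL.coe_nnreal_ennreal hL₁ hdist hx₀] with ω hω
  refine cauchySeq_tendsto_of_complete (cauchySeq_of_edist_le_of_tsum_ne_top _ (fun t => ?_) hω.ne)
  simpa [backwardIterate] using lipschitzWith_backwardIterate hΦL ω t x₀ (Φ (ω t) x₀)

lemma exists_measurable_limit_backwardIterate [CompleteSpace S]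
    (hΦ : Measurable (Function.uncurry Φ)) (hΦL : ∀ w, LipschitzWith (L w) (Φ w))
    (hL : Measurable L) (hL₁ : ∫⁻ w, L w ∂μ < 1) (hx₀ : ∫⁻ w, edist x₀ (Φ w x₀) ∂μ ≠ ⊤) :
    ∃ X : (ℕ → W) → S, Measurable X ∧ ∀ᵐ ω ∂(Measure.infinitePi fun _ : ℕ => μ), ∀ x,
      Tendsto (fun t => backwardIterate Φ ω t x) atTop (𝓝 (X ω)) := by
  obtain ⟨X, hX, hlim⟩ := measurable_limit_of_tendsto_metrizable_ae
    (fun t => ((measurable_backwardIterate hΦ t).comp measurable_prodMk_right).aemeasurable)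
    (ae_exists_tendsto_backwardIterate hΦ hΦL hL hL₁ hx₀)
  refine ⟨X, hX, ?_⟩
  filter_upwards [hlim, ae_tendsto_prod_range_zero hL.coe_nnreal_ennreal hL₁] with ω hω hprod x
  rw [tendsto_iff_edist_tendsto_0] at hω ⊢
  have hbound : Tendsto (fun t => (∏ i ∈ Finset.range t, (L (ω i) : ℝ≥0∞)) * edist x x₀
      + edist (backwardIterate Φ ω t x₀) (X ω)) atTop (𝓝 0) := by
    simpa using (ENNReal.Tendsto.mul_const hprod (Or.inr (edist_ne_top x x₀))).add hω
  refine tendsto_of_tendsto_of_tendsto_of_le_of_le tendsto_const_nhds hbound (fun _ => zero_le)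
    fun t => (edist_triangle _ (backwardIterate Φ ω t x₀) _).trans ?_
  gcongr
  simpa using lipschitzWith_backwardIterate hΦL ω t x x₀

lemma continuous_integral_randomMapKernel (hΦ : Measurable (Function.uncurry Φ))
    (hΦc : ∀ w, Continuous (Φ w)) (h : S →ᵇ ℝ) :
    Continuous fun x => ∫ y, h y ∂randomMapKernel μ Φ x := by
  have hΦx (x : S) : Measurable fun w => Φ w x := hΦ.comp measurable_prodMk_right
  have hh := h.continuous.measurable
  simp only [randomMapKernel_apply hΦ,
    fun x => integral_map (hΦx x).aemeasurable (μ := μ) hh.aestronglyMeasurable]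
  exact continuous_of_dominated (bound := fun _ => ‖h‖)
    (fun x => (hh.comp (hΦx x)).aestronglyMeasurable)
    (fun x => ae_of_all _ fun w => h.norm_coe_le_norm _) (integrable_const _)
    (ae_of_all _ fun w => h.continuous.comp (hΦc w))

lemma tendsto_integral_randomMapKernel_pow (hΦ : Measurable (Function.uncurry Φ))
    {X : (ℕ → W) → S} (hX : Measurable X) {x : S}
    (hlim : ∀ᵐ ω ∂(Measure.infinitePi fun _ : ℕ => μ),
      Tendsto (fun t => backwardIterate Φ ω t x) atTop (𝓝 (X ω))) (h : S →ᵇ ℝ) :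
    Tendsto (fun t : ℕ => ∫ y, h y ∂(randomMapKernel μ Φ ^ t : Kernel S S) x) atTop
      (𝓝 (∫ y, h y ∂(Measure.infinitePi fun _ : ℕ => μ).map X)) := by
  have hB (t : ℕ) : Measurable fun ω => backwardIterate Φ ω t x :=
    (measurable_backwardIterate hΦ t).comp measurable_prodMk_right
  have hh := h.continuous.measurable
  simp only [randomMapKernel_pow_apply hΦ, integral_map hX.aemeasurable hh.aestronglyMeasurable,
    fun t => integral_map (hB t).aemeasurable (μ := .infinitePi fun _ => μ)
      hh.aestronglyMeasurable]
  refine tendsto_integral_of_dominated_convergence (fun _ => ‖h‖)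
    (fun t => (hh.comp (hB t)).aestronglyMeasurable) (integrable_const _)
    (fun t => ae_of_all _ fun ω => h.norm_coe_le_norm _) ?_
  filter_upwards [hlim] with ω hω
  exact (h.continuous.tendsto _).comp hω

theorem globallyStable_randomMapKernel [CompleteSpace S] (hΦ : Measurable (Function.uncurry Φ))
    (hΦL : ∀ w, LipschitzWith (L w) (Φ w)) (hL : Measurable L) (hL₁ : ∫⁻ w, L w ∂μ < 1)
    (hx₀ : ∫⁻ w, edist x₀ (Φ w x₀) ∂μ ≠ ⊤) : GloballyStable (randomMapKernel μ Φ) := by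
  obtain ⟨X, hX, hlim⟩ := exists_measurable_limit_backwardIterate hΦ hΦL hL hL₁ hx₀
  have := isMarkovKernel_randomMapKernel (μ := μ) hΦ
  have := Measure.isProbabilityMeasure_map (μ := .infinitePi fun _ => μ) hX.aemeasurable
  exact globallyStable_of_feller
    (continuous_integral_randomMapKernel hΦ fun w => (hΦL w).continuous)
    fun x => tendsto_integral_randomMapKernel_pow hΦ hX (hlim.mono fun ω hω => hω x)

end RandomLipschitzMaps

namespace IncomeFluctuation

noncomputable section

variable {Z E F : Type*} [MeasurableSpace Z] [MeasurableSpace E] [MeasurableSpace F]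

section Utility

variable {M : IncomeFluctuation Z E F}

lemma marg_zero (M : IncomeFluctuation Z E F) : M.marg 0 = ⊤ := if_pos rfl

lemma marg_of_pos (M : IncomeFluctuation Z E F) {x : ℝ≥0} (hx : 0 < x) :
    M.marg x = ENNReal.ofReal (M.u' x) := if_neg hx.ne'

lemma marg_eq_top_iff {x : ℝ≥0} : M.marg x = ⊤ ↔ x = 0 := by
  simp [marg, ENNReal.ofReal_ne_top]

namespace UtilityAssumption

variable (hu : M.UtilityAssumption)

include hu

lemma strictAntiOn_u' : StrictAntiOn M.u' (Ioi 0) :=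
  strictAntiOn_of_deriv_neg (convex_Ioi 0)
    (fun x hx => (hu.differentiableAt_deriv x hx).continuousAt.continuousWithinAt)
    (fun x hx => hu.deriv2_neg x (by simpa using hx))

lemma continuousOn_uReal : ContinuousOn M.uReal (Ioi 0) :=
  fun x hx => (hu.differentiableAt x hx).continuousAt.continuousWithinAt

lemma strictMonoOn_uReal : StrictMonoOn M.uReal (Ioi 0) :=
  strictMonoOn_of_deriv_pos (convex_Ioi 0) hu.continuousOn_uReal
    (fun x hx => hu.deriv_pos x (by simpa using hx))

lemma strictConcaveOn_uReal : StrictConcaveOn ℝ (Ioi 0) M.uReal :=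
  StrictAntiOn.strictConcaveOn_of_deriv (convex_Ioi 0) hu.continuousOn_uReal
    (by rw [interior_Ioi]; exact hu.strictAntiOn_u')

lemma u_eq_uReal {x : ℝ≥0} (hx : 0 < x) : M.u x = (M.uReal x : EReal) := by
  rw [uReal, Real.toNNReal_coe, EReal.coe_toReal (hu.ne_top x) (hu.ne_bot x hx)]

lemma monotone_u : Monotone M.u := by
  intro x y hxy
  rcases eq_zero_or_pos x with rfl | hx
  · rcases eq_zero_or_pos y with rfl | hy
    · exact le_rfl
    · exact hu.zero_le y hy
  · have hy := hx.trans_le hxy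
    rw [hu.u_eq_uReal hx, hu.u_eq_uReal hy, EReal.coe_le_coe_iff]
    exact hu.strictMonoOn_uReal.monotoneOn (mem_Ioi.2 hx) (mem_Ioi.2 hy) hxy

lemma measurable_u : Measurable M.u := hu.monotone_u.measurable

lemma exists_u'_eq {y : ℝ} (hy : 0 < y) : ∃ x ∈ Ioi (0 : ℝ), M.u' x = y := by
  have hcont : ContinuousOn M.u' (Ioi 0) :=
    fun x hx => (hu.differentiableAt_deriv x hx).continuousAt.continuousWithinAt
  obtain ⟨b, hb0, hb⟩ := ((eventually_gt_atTop 0).and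
    (hu.tendsto_atTop.eventually_lt_const hy)).exists
  obtain ⟨a, ha0, ha⟩ := ((eventually_mem_nhdsWithin).and
    (hu.tendsto_zero.eventually_ge_atTop y)).exists
  exact isPreconnected_Ioi.intermediate_value hb0 ha0 hcont ⟨hb.le, ha⟩

lemma u'Inv_pos {y : ℝ} (hy : 0 < y) : 0 < M.u'Inv y :=
  Function.invFunOn_mem (hu.exists_u'_eq hy)

lemma u'_u'Inv {y : ℝ} (hy : 0 < y) : M.u' (M.u'Inv y) = y :=
  Function.invFunOn_eq (hu.exists_u'_eq hy)

lemma marg_pos (x : ℝ≥0) : 0 < M.marg x := by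
  rcases eq_zero_or_pos x with rfl | hx
  · simp [marg_zero]
  · rw [M.marg_of_pos hx]
    exact ENNReal.ofReal_pos.2 (hu.deriv_pos x hx)

lemma strictAnti_marg : StrictAnti M.marg := by
  intro x y hxy
  rcases eq_zero_or_pos x with rfl | hx
  · rw [marg_zero]
    exact lt_top_iff_ne_top.2 (mt marg_eq_top_iff.1 hxy.ne')
  · rw [M.marg_of_pos hx, M.marg_of_pos (hx.trans hxy)]
    exact (ENNReal.ofReal_lt_ofReal_iff (hu.deriv_pos x hx)).2
      (hu.strictAntiOn_u' hx (hx.trans hxy) hxy)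

lemma antitone_marg : Antitone M.marg := hu.strictAnti_marg.antitone

lemma le_marg_iff {x : ℝ≥0} (hx : 0 < x) {y : ℝ≥0∞} (hy₀ : y ≠ 0) (hy : y ≠ ⊤) :
    y ≤ M.marg x ↔ (x : ℝ) ≤ M.u'Inv y.toReal := by
  have hy_pos : 0 < y.toReal := ENNReal.toReal_pos hy₀ hy
  rw [← hu.strictAntiOn_u'.le_iff_ge (mem_Ioi.2 (hu.u'Inv_pos hy_pos)) (NNReal.coe_pos.2 hx),
    hu.u'_u'Inv hy_pos, M.marg_of_pos hx,
    ENNReal.le_ofReal_iff_toReal_le hy (hu.deriv_pos x hx).le]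

lemma continuousAt_marg_zero : ContinuousAt M.marg 0 := by
  rw [ContinuousAt, marg_zero, ENNReal.tendsto_nhds_top_iff_nnreal]
  intro K
  have hK := hu.tendsto_zero.eventually_gt_atTop (K : ℝ)
  rw [eventually_nhdsWithin_iff] at hK
  filter_upwards [(NNReal.continuous_coe.tendsto 0).eventually hK] with y hy
  rcases eq_zero_or_pos y with rfl | hy0
  · simp [marg_zero]
  · have hlt : (K : ℝ) < M.u' y := hy hy0
    rw [M.marg_of_pos hy0, ← ENNReal.ofReal_coe_nnreal]
    exact (ENNReal.ofReal_lt_ofReal_iff (K.coe_nonneg.trans_lt hlt)).2 hlt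

lemma continuous_marg : Continuous M.marg := by
  refine continuous_iff_continuousAt.2 fun x => ?_
  rcases eq_zero_or_pos x with rfl | hx
  · exact hu.continuousAt_marg_zero
  · have hcont : ContinuousAt (fun y : ℝ≥0 => ENNReal.ofReal (M.u' y)) x :=
      ENNReal.continuous_ofReal.continuousAt.comp
        (ContinuousAt.comp (f := fun y : ℝ≥0 => (y : ℝ))
          (hu.differentiableAt_deriv x hx).continuousAt NNReal.continuous_coe.continuousAt)
    exact hcont.congr ((lt_mem_nhds hx).mono fun y hy => (M.marg_of_pos hy).symm)

lemma measurable_marg : Measurable M.marg := hu.continuous_marg.measurable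

lemma uReal_lt_tangent {c d : ℝ≥0} (hc : 0 < c) (hdc : d ≠ c) {r : ℝ} (hr : M.u d = r) :
    r < M.uReal c + M.u' c * (d - c) := by
  rcases eq_zero_or_pos d with rfl | hd
  · refine lt_tangent_left_of_strictConcaveOn_Ioi hu.strictConcaveOn_uReal (fun y hy => ?_)
      (mem_Ioi.2 hc) (hu.differentiableAt c hc)
    lift y to ℝ≥0 using (mem_Ioi.1 hy).le
    rw [← EReal.coe_le_coe_iff, ← hr, ← hu.u_eq_uReal hy]
    exact hu.zero_le y hy
  · rw [hu.u_eq_uReal hd, EReal.coe_eq_coe_iff] at hr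
    rw [← hr]
    exact lt_tangent_of_strictConcaveOn hu.strictConcaveOn_uReal (mem_Ioi.2 hc) (mem_Ioi.2 hd)
      (NNReal.coe_injective.ne hdc) (hu.differentiableAt c hc)

/-- The tangent inequality `u d < u c + u'(c) (d - c)`, arranged so that every term lies in
`[0, ∞]`. -/
lemma toENNReal_u_add_lt {c d : ℝ≥0} (hc : 0 < c) (hdc : d ≠ c) :
    (M.u d).toENNReal + (-M.u c).toENNReal + M.marg c * c
      < (M.u c).toENNReal + (-M.u d).toENNReal + M.marg c * d := by
  have hmul (x : ℝ≥0) : M.marg c * x = ENNReal.ofReal (M.u' c * x) := by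
    rw [M.marg_of_pos hc, ENNReal.ofReal_mul (hu.deriv_pos c hc).le, ENNReal.ofReal_coe_nnreal]
  have hmul_nonneg (x : ℝ≥0) : 0 ≤ M.u' c * x := mul_nonneg (hu.deriv_pos c hc).le x.coe_nonneg
  rw [hmul, hmul, hu.u_eq_uReal hc]
  induction hud : M.u d with
  | bot => simp [← EReal.coe_neg, ENNReal.add_lt_top]
  | top => exact absurd hud (hu.ne_top d)
  | coe r =>
    exact toENNReal_add_toENNReal_neg_add_lt (hmul_nonneg c) (hmul_nonneg d)
      (by linarith [hu.uReal_lt_tangent hc hdc hud])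

lemma toENNReal_u_add_le (c d : ℝ≥0) :
    (M.u d).toENNReal + (-M.u c).toENNReal + M.marg c * c
      ≤ (M.u c).toENNReal + (-M.u d).toENNReal + M.marg c * d := by
  rcases eq_or_ne d c with rfl | hdc
  · rfl
  rcases eq_zero_or_pos c with rfl | hc
  · simp [marg_zero, ENNReal.top_mul (ENNReal.coe_ne_zero.2 hdc)]
  · exact (hu.toENNReal_u_add_lt hc hdc).le

lemma toENNReal_u_le (x : ℝ≥0) :
    (M.u x).toENNReal ≤ (M.u 1).toENNReal + M.marg 1 * x := by
  rcases le_total (M.u x) 0 with hux | hux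
  · simp [EReal.toENNReal_of_nonpos hux]
  · have htangent := hu.toENNReal_u_add_le 1 x
    rw [EReal.toENNReal_of_nonpos (EReal.neg_le_zero.2 hux), add_zero, add_assoc] at htangent
    exact le_self_add.trans htangent

lemma toENNReal_neg_u_le (x : ℝ≥0) :
    (-M.u x).toENNReal ≤ (-M.u 1).toENNReal + M.marg x := by
  rcases le_total 0 (M.u x) with hux | hux
  · simp [EReal.toENNReal_of_nonpos (EReal.neg_le_zero.2 hux)]
  · have htangent := hu.toENNReal_u_add_le x 1
    rw [EReal.toENNReal_of_nonpos hux, zero_add, ENNReal.coe_one, mul_one] at htangent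
    exact (le_add_self.trans le_self_add).trans htangent

lemma marg_mul_self_le (x : ℝ≥0) : M.marg x * x ≤ M.marg x + M.marg 1 * x := by
  rcases le_total x 1 with hx | hx
  · exact (mul_le_of_le_one_right' (by exact_mod_cast hx)).trans le_self_add
  · exact le_add_left (mul_le_mul_left (hu.antitone_marg hx) _)

end UtilityAssumption

end Utility

section PathLaw

variable (M : IncomeFluctuation Z E F)

instance : IsProbabilityMeasure M.pathLaw := by
  unfold pathLaw
  infer_instance

@[fun_prop]
lemma measurable_ret : Measurable M.ret :=
  M.measurable_R.comp (measurable_fst.prodMk (measurable_fst.comp measurable_snd))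

@[fun_prop]
lemma measurable_inc : Measurable M.inc :=
  M.measurable_Y.comp (measurable_fst.prodMk (measurable_snd.comp measurable_snd))

/-- The mean return `𝔼 R`. -/
def meanRet : ℝ≥0∞ := ∫⁻ w, M.ret w ∂M.shock

/-- The mean labour income `𝔼 Y`. -/
def meanInc : ℝ≥0∞ := ∫⁻ w, M.inc w ∂M.shock

lemma expInc_eq (t : ℕ) : M.expInc t = M.meanInc :=
  lintegral_infinitePi_eval (μ := fun _ : ℕ => M.shock) (i := t)
    (f := fun w => (M.inc w : ℝ≥0∞)) (by fun_prop)

lemma expProdRet_eq (n : ℕ) : M.expProdRet n = M.meanRet ^ n := by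
  have hprod := lintegral_infinitePi_prod (μ := fun _ : ℕ => M.shock) (Finset.range n)
    (f := fun _ w => (M.ret w : ℝ≥0∞)) fun _ => by fun_prop
  rwa [Finset.prod_const, Finset.card_range] at hprod

variable {M}

lemma mul_meanRet_lt_one {x : ℝ≥0∞} {n : ℕ} (h : x ^ n * M.expProdRet n < 1) :
    x * M.meanRet < 1 := by
  rw [expProdRet_eq, ← mul_pow] at h
  by_contra! hge
  exact h.not_ge (one_le_pow₀ hge)

lemma ContractionAssumption.mul_meanRet_lt_one (h : M.ContractionAssumption) :
    M.β * M.meanRet < 1 :=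
  let ⟨_, hn⟩ := h
  IncomeFluctuation.mul_meanRet_lt_one hn

lemma IncomeBoundAssumption.meanInc_ne_top (h : M.IncomeBoundAssumption) : M.meanInc ≠ ⊤ := by
  rw [← M.expInc_eq 0]
  exact ((le_iSup M.expInc 0).trans_lt h).ne

end PathLaw

section TimeIteration

variable (M : IncomeFluctuation Z E F)

/-- The discounted expected marginal value `β 𝔼 R u'(c(R s + Y))` of saving `s`, when next
period's consumption is the function `c` of wealth. -/
def savingValue (c : ℝ≥0 → ℝ≥0) (s : ℝ≥0) : ℝ≥0∞ :=
  M.β * ∫⁻ w, M.ret w * M.marg (c (M.nextWealth s w)) ∂M.shock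

/-- The bound `β 𝔼 R (u'(Y) + κ)` on the marginal value of saving under a policy `c` with
`u' ∘ c ≤ u' + κ`. -/
def savingValueBound (κ : ℝ≥0) : ℝ≥0∞ :=
  M.β * ∫⁻ w, M.ret w * (M.marg (M.inc w) + κ) ∂M.shock

/-- The time iteration operator: `timeIter c a` is the largest consumption `ξ ≤ a` with
`β 𝔼 R u'(c(R (a - ξ) + Y)) ≤ u'(ξ)`. -/
def timeIter (c : ℝ≥0 → ℝ≥0) (a : ℝ≥0) : ℝ≥0 :=
  sSup {ξ | ξ ≤ a ∧ M.savingValue c (a - ξ) ≤ M.marg ξ}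

/-- Consumption functions of wealth such that consumption and saving are increasing and the
marginal utility of consumption exceeds that of wealth by at most `κ`. -/
structure WealthPolicy (κ : ℝ≥0) (c : ℝ≥0 → ℝ≥0) : Prop where
  mono : Monotone c
  le_add : ∀ a b, a ≤ b → c b ≤ c a + (b - a)
  le_self : ∀ a, c a ≤ a
  marg_le : ∀ a, M.marg (c a) ≤ M.marg a + κ

variable {M} {α κ : ℝ≥0} {c d : ℝ≥0 → ℝ≥0}

lemma monotone_nextWealth (w : Z × E × F) : Monotone fun s => M.nextWealth s w := by
  intro s t hst
  simp only [nextWealth]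
  gcongr

lemma inc_le_nextWealth (s : ℝ≥0) (w : Z × E × F) : M.inc w ≤ M.nextWealth s w := le_add_self

@[fun_prop]
lemma measurable_nextWealth :
    Measurable fun p : ℝ≥0 × (Z × E × F) => M.nextWealth p.1 p.2 := by
  unfold nextWealth
  fun_prop

lemma savingValue_anti (hu : M.UtilityAssumption) (hcd : c ≤ d) (s : ℝ≥0) :
    M.savingValue d s ≤ M.savingValue c s := by
  unfold savingValue
  gcongr
  exact hu.antitone_marg (hcd _)

lemma antitone_savingValue (hu : M.UtilityAssumption) (hc : Monotone c) :
    Antitone (M.savingValue c) := by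
  intro s t hst
  unfold savingValue
  gcongr
  exact hu.antitone_marg (hc (monotone_nextWealth _ hst))

lemma measurable_ret_mul_marg (hu : M.UtilityAssumption) (hc : Measurable c) (s : ℝ≥0) :
    Measurable fun w => M.ret w * M.marg (c (M.nextWealth s w)) := by
  have := hu.measurable_marg
  fun_prop

lemma savingValue_eq_zero_iff (hu : M.UtilityAssumption) (hc : Measurable c) (s : ℝ≥0) :
    M.savingValue c s = 0 ↔ M.β = 0 ∨ ∀ᵐ w ∂M.shock, M.ret w = 0 := by
  rw [savingValue, mul_eq_zero, lintegral_eq_zero_iff (measurable_ret_mul_marg hu hc s)]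
  simp [Filter.EventuallyEq, (hu.marg_pos _).ne']

lemma savingValueBound_eq (κ : ℝ≥0) :
    M.savingValueBound κ
      = M.β * ∫⁻ w, M.ret w * M.marg (M.inc w) ∂M.shock + M.β * M.meanRet * κ := by
  have hret : Measurable fun w => (M.ret w : ℝ≥0∞) := by fun_prop
  simp only [savingValueBound, mul_add]
  rw [lintegral_add_right _ (hret.mul_const _), lintegral_mul_const _ hret, mul_add, ← mul_assoc,
    meanRet]

lemma exists_savingValueBound_le (hmom : M.MomentAssumption) (hθ : M.β * M.meanRet < 1) :
    ∃ κ : ℝ≥0, M.savingValueBound κ ≤ κ := by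
  simp only [savingValueBound_eq]
  exact exists_nnreal_add_mul_le (ENNReal.mul_ne_top ENNReal.coe_ne_top hmom.2.2.ne) hθ

lemma lintegral_ret_mul_marg_add_ne_top (hmom : M.MomentAssumption) (κ : ℝ≥0) :
    ∫⁻ w, M.ret w * (M.marg (M.inc w) + κ) ∂M.shock ≠ ⊤ := by
  simp only [mul_add]
  rw [lintegral_add_right _ (by fun_prop), lintegral_mul_const _ (by fun_prop)]
  exact ENNReal.add_ne_top.2 ⟨hmom.2.2.ne, ENNReal.mul_ne_top hmom.1.ne ENNReal.coe_ne_top⟩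

lemma wealthPolicy_id (M : IncomeFluctuation Z E F) (κ : ℝ≥0) : M.WealthPolicy κ id where
  mono := monotone_id
  le_add _ _ hab := (add_tsub_cancel_of_le hab).ge
  le_self _ := le_rfl
  marg_le _ := le_self_add

namespace WealthPolicy

lemma continuous (hc : M.WealthPolicy κ c) : Continuous c := by
  have hlip : LipschitzWith 1 fun a => (c a : ℝ) := by
    refine LipschitzWith.of_le_add fun a b => ?_
    rcases le_total a b with hab | hba
    · exact (NNReal.coe_le_coe.2 (hc.mono hab)).trans (le_add_of_nonneg_right dist_nonneg)
    · refine (NNReal.coe_le_coe.2 (hc.le_add b a hba)).trans ?_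
      rw [NNReal.dist_eq, ← NNReal.coe_sub hba, NNReal.abs_eq, NNReal.coe_add]
  exact NNReal.isEmbedding_coe.continuous_iff.2 hlip.continuous

lemma measurable (hc : M.WealthPolicy κ c) : Measurable c := hc.continuous.measurable

lemma pos (hc : M.WealthPolicy κ c) {a : ℝ≥0} (ha : 0 < a) : 0 < c a := by
  have hfin : M.marg (c a) ≠ ⊤ := ne_top_of_le_ne_top
    (ENNReal.add_ne_top.2 ⟨mt marg_eq_top_iff.1 ha.ne', ENNReal.coe_ne_top⟩) (hc.marg_le a)
  exact pos_iff_ne_zero.2 fun h => hfin (marg_eq_top_iff.2 h)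

lemma marg_nextWealth_le (hc : M.WealthPolicy κ c) (hu : M.UtilityAssumption) (s : ℝ≥0)
    (w : Z × E × F) : M.marg (c (M.nextWealth s w)) ≤ M.marg (M.inc w) + κ :=
  (hc.marg_le _).trans (by gcongr; exact hu.antitone_marg (inc_le_nextWealth s w))

lemma savingValue_le (hc : M.WealthPolicy κ c) (hu : M.UtilityAssumption) (s : ℝ≥0) :
    M.savingValue c s ≤ M.savingValueBound κ := by
  unfold savingValue savingValueBound
  gcongr
  exact hc.marg_nextWealth_le hu _ _

lemma savingValue_ne_top (hc : M.WealthPolicy κ c) (hu : M.UtilityAssumption)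
    (hmom : M.MomentAssumption) (s : ℝ≥0) : M.savingValue c s ≠ ⊤ :=
  ne_top_of_le_ne_top
    (ENNReal.mul_ne_top ENNReal.coe_ne_top (lintegral_ret_mul_marg_add_ne_top hmom κ))
    (hc.savingValue_le hu s)

lemma candidate [TopologicalSpace Z] (hc : M.WealthPolicy κ c) (hu : M.UtilityAssumption) :
    M.Candidate fun s => c s.1 where
  continuousOn := (hc.continuous.comp continuous_fst).continuousOn
  mono _ _ _ _ hab := hc.mono hab
  pos a _ ha := hc.pos ha
  le a _ := hc.le_self a
  bounded := by
    refine ⟨κ, fun a _ ha => ?_⟩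
    have hca := hc.pos ha
    have hu'_le : M.u' a ≤ M.u' (c a) := hu.strictAntiOn_u'.antitoneOn hca ha (hc.le_self a)
    have hmarg := hc.marg_le a
    rw [M.marg_of_pos ha, M.marg_of_pos hca, ← ENNReal.ofReal_coe_nnreal,
      ← ENNReal.ofReal_add (hu.deriv_pos a ha).le κ.coe_nonneg,
      ENNReal.ofReal_le_ofReal_iff (add_nonneg (hu.deriv_pos a ha).le κ.coe_nonneg)] at hmarg
    rw [abs_of_nonneg (sub_nonneg.2 hu'_le)]
    linarith

end WealthPolicy

/-- Both continuity of `savingValue` in saving and its convergence along policies are instances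
of this dominated convergence. -/
lemma tendsto_savingValue (hu : M.UtilityAssumption) (hmom : M.MomentAssumption)
    {cs : ℕ → ℝ≥0 → ℝ≥0} {ss : ℕ → ℝ≥0} {s : ℝ≥0} (hcs : ∀ n, M.WealthPolicy κ (cs n))
    (hlim : ∀ w, Tendsto (fun n => cs n (M.nextWealth (ss n) w)) atTop
      (𝓝 (c (M.nextWealth s w)))) :
    Tendsto (fun n => M.savingValue (cs n) (ss n)) atTop (𝓝 (M.savingValue c s)) := by
  refine ENNReal.Tendsto.const_mul ?_ (Or.inr ENNReal.coe_ne_top)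
  refine tendsto_lintegral_of_dominated_convergence
    (fun w => M.ret w * (M.marg (M.inc w) + κ))
    (fun n => measurable_ret_mul_marg hu (hcs n).measurable _)
    (fun n => ae_of_all _ fun w => ?_) (lintegral_ret_mul_marg_add_ne_top hmom κ)
    (ae_of_all _ fun w => ?_)
  · exact mul_le_mul_right ((hcs n).marg_nextWealth_le hu _ w) _
  · exact ENNReal.Tendsto.const_mul ((hu.continuous_marg.tendsto _).comp (hlim w))
      (Or.inr ENNReal.coe_ne_top)

lemma WealthPolicy.continuous_savingValue (hc : M.WealthPolicy κ c) (hu : M.UtilityAssumption)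
    (hmom : M.MomentAssumption) : Continuous (M.savingValue c) := by
  refine continuous_iff_seqContinuous.2 fun ss s hss =>
    tendsto_savingValue hu hmom (fun _ => hc) fun w => ?_
  have hcont : Continuous fun s => c (M.nextWealth s w) := by
    have := hc.continuous
    unfold nextWealth
    fun_prop
  exact (hcont.tendsto s).comp hss

lemma timeIter_le_self (c : ℝ≥0 → ℝ≥0) (a : ℝ≥0) : M.timeIter c a ≤ a :=
  csSup_le ⟨0, zero_le, by rw [marg_zero]; exact le_top⟩ fun _ h => h.1

lemma le_timeIter {ξ a : ℝ≥0} (hξ : ξ ≤ a) (h : M.savingValue c (a - ξ) ≤ M.marg ξ) :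
    ξ ≤ M.timeIter c a :=
  le_csSup ⟨a, fun _ h => h.1⟩ ⟨hξ, h⟩

namespace WealthPolicy

variable (hc : M.WealthPolicy κ c) (hu : M.UtilityAssumption) (hmom : M.MomentAssumption)

include hc hu hmom

lemma savingValue_timeIter_le (a : ℝ≥0) :
    M.savingValue c (a - M.timeIter c a) ≤ M.marg (M.timeIter c a) := by
  have hclosed : IsClosed {ξ | ξ ≤ a ∧ M.savingValue c (a - ξ) ≤ M.marg ξ} :=
    (isClosed_le continuous_id continuous_const).inter (isClosed_le
      ((hc.continuous_savingValue hu hmom).comp (continuous_const.sub continuous_id))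
      hu.continuous_marg)
  exact (hclosed.csSup_mem ⟨0, zero_le, by rw [marg_zero]; exact le_top⟩ ⟨a, fun _ h => h.1⟩).2

lemma savingValue_timeIter_eq {a : ℝ≥0} (ha : M.timeIter c a < a) :
    M.savingValue c (a - M.timeIter c a) = M.marg (M.timeIter c a) := by
  refine (hc.savingValue_timeIter_le hu hmom a).antisymm (not_lt.1 fun hlt => ?_)
  have hopen : IsOpen {ξ | ξ < a ∧ M.savingValue c (a - ξ) < M.marg ξ} :=
    (isOpen_lt continuous_id continuous_const).inter (isOpen_lt
      ((hc.continuous_savingValue hu hmom).comp (continuous_const.sub continuous_id))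
      hu.continuous_marg)
  have : (𝓝[>] (M.timeIter c a)).NeBot := nhdsGT_neBot_of_exists_gt ⟨a, ha⟩
  obtain ⟨ξ, hξ, hgt⟩ := ((eventually_nhdsWithin_of_eventually_nhds
    (hopen.mem_nhds ⟨ha, hlt⟩)).and (self_mem_nhdsWithin (s := Ioi (M.timeIter c a)))).exists
  exact (le_timeIter hξ.1.le hξ.2.le).not_gt hgt

lemma timeIter_pos {a : ℝ≥0} (ha : 0 < a) : 0 < M.timeIter c a := by
  refine pos_iff_ne_zero.2 fun hzero => hc.savingValue_ne_top hu hmom (a - M.timeIter c a) ?_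
  rw [hc.savingValue_timeIter_eq hu hmom (hzero ▸ ha), hzero, marg_zero]

lemma timeIter_mono (hcd : c ≤ d) : M.timeIter c ≤ M.timeIter d := fun a =>
  le_timeIter (timeIter_le_self c a)
    ((savingValue_anti hu hcd _).trans (hc.savingValue_timeIter_le hu hmom a))

lemma monotone_timeIter : Monotone (M.timeIter c) := fun a _ hab =>
  le_timeIter ((timeIter_le_self c a).trans hab)
    ((antitone_savingValue hu hc.mono (tsub_le_tsub_right hab _)).trans
      (hc.savingValue_timeIter_le hu hmom a))

lemma timeIter_le_add {a b : ℝ≥0} (hab : a ≤ b) :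
    M.timeIter c b ≤ M.timeIter c a + (b - a) := by
  rw [← tsub_le_iff_right]
  rcases le_total (M.timeIter c b) (b - a) with hle | hge
  · exact (tsub_eq_zero_of_le hle).trans_le zero_le
  have hsaving : a - (M.timeIter c b - (b - a)) = b - M.timeIter c b := by
    rw [tsub_tsub_eq_add_tsub_of_le hge, add_tsub_cancel_of_le hab]
  refine le_timeIter ?_ ?_
  · rw [tsub_le_iff_right, add_tsub_cancel_of_le hab]
    exact timeIter_le_self c b
  · rw [hsaving]
    exact (hc.savingValue_timeIter_le hu hmom b).trans (hu.antitone_marg tsub_le_self)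

lemma marg_timeIter_le (hκ : M.savingValueBound κ ≤ κ) (a : ℝ≥0) :
    M.marg (M.timeIter c a) ≤ M.marg a + κ := by
  rcases (timeIter_le_self (M := M) c a).eq_or_lt with heq | hlt
  · rw [heq]
    exact le_self_add
  · rw [← hc.savingValue_timeIter_eq hu hmom hlt]
    exact ((hc.savingValue_le hu _).trans hκ).trans le_add_self

lemma timeIter (hκ : M.savingValueBound κ ≤ κ) : M.WealthPolicy κ (M.timeIter c) where
  mono := hc.monotone_timeIter hu hmom
  le_add _ _ := hc.timeIter_le_add hu hmom
  le_self := timeIter_le_self c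
  marg_le := hc.marg_timeIter_le hu hmom hκ

lemma convex_savingValue_le_marg [TopologicalSpace Z] (hconc : M.ConcavityAssumption)
    (hcc : ConcaveOn ℝ≥0 (Ioi 0) c) :
    Convex ℝ≥0 {p : ℝ≥0 × ℝ≥0 | 0 < p.2 ∧ M.savingValue c p.1 ≤ M.marg p.2} := by
  have hzero_iff := savingValue_eq_zero_iff hu hc.measurable
  have hinv : ConcaveOn ℝ (Ici 0) fun s : ℝ => M.u'Inv (M.savingValue c s.toNNReal).toReal := by
    unfold savingValue nextWealth
    exact hconc (fun s => c s.1) (hc.candidate hu) fun _ => concaveOn_coe_toNNReal hcc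
  rintro ⟨s, ξ⟩ ⟨hξ, hs⟩ ⟨t, η⟩ ⟨hη, ht⟩ p q hp hq hpq
  have hpos : 0 < p • ξ + q • η := convex_Ioi (𝕜 := ℝ≥0) (0 : ℝ≥0) hξ hη hp hq hpq
  refine ⟨hpos, ?_⟩
  by_cases hdeg : M.β = 0 ∨ ∀ᵐ w ∂M.shock, M.ret w = 0
  · exact ((hzero_iff _).2 hdeg).trans_le zero_le
  have hle_iff (s : ℝ≥0) {ξ : ℝ≥0} (hξ : 0 < ξ) :=
    hu.le_marg_iff hξ (mt (hzero_iff s).1 hdeg) (hc.savingValue_ne_top hu hmom s)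
  rw [hle_iff _ hξ] at hs
  rw [hle_iff _ hη] at ht
  refine (hle_iff _ hpos).2 ?_
  have hcomb := hinv.2 (mem_Ici.2 s.coe_nonneg) (mem_Ici.2 t.coe_nonneg) p.coe_nonneg
    q.coe_nonneg (by exact_mod_cast hpq)
  simp only [smul_eq_mul, ← NNReal.coe_mul, ← NNReal.coe_add, Real.toNNReal_coe] at hcomb
  refine le_trans ?_ hcomb
  push_cast [smul_eq_mul]
  gcongr

lemma concaveOn_timeIter [TopologicalSpace Z] (hconc : M.ConcavityAssumption)
    (hcc : ConcaveOn ℝ≥0 (Ioi 0) c) : ConcaveOn ℝ≥0 (Ioi 0) (M.timeIter c) := by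
  refine ⟨convex_Ioi 0, fun a ha b hb p q hp hq hpq => ?_⟩
  have hle (x : ℝ≥0) : M.timeIter c x ≤ x := timeIter_le_self c x
  have hmem (x : ℝ≥0) (hx : 0 < x) : (x - M.timeIter c x, M.timeIter c x) ∈
      {p : ℝ≥0 × ℝ≥0 | 0 < p.2 ∧ M.savingValue c p.1 ≤ M.marg p.2} :=
    ⟨hc.timeIter_pos hu hmom hx, hc.savingValue_timeIter_le hu hmom x⟩
  have hcomb := (hc.convex_savingValue_le_marg hu hmom hconc hcc (hmem a ha) (hmem b hb)
    hp hq hpq).2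
  have hsaving : p • (a - M.timeIter c a) + q • (b - M.timeIter c b)
      = p • a + q • b - (p • M.timeIter c a + q • M.timeIter c b) := by
    simp only [smul_eq_mul, mul_tsub]
    exact tsub_add_tsub_comm (mul_le_mul_right (hle a) p) (mul_le_mul_right (hle b) q)
  refine le_timeIter (by gcongr <;> exact hle _) ?_
  rwa [← hsaving]

end WealthPolicy

/-- The inequality of `SavingAssumption` for a given `α`: consuming the fraction `α` of wealth
is worthwhile if the same is done in the next period and there is no labour income. -/
def SavingInequality (M : IncomeFluctuation Z E F) (α : ℝ≥0) : Prop :=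
  ∀ a : ℝ≥0, 0 < a → M.β * ∫⁻ w, M.ret w * M.marg (M.ret w * (1 - α) * a) ∂M.shock ≤ M.marg a

lemma SavingInequality.mul_le_timeIter (hsav : M.SavingInequality α) (hu : M.UtilityAssumption)
    (hα : 0 < α) (hα₁ : α ≤ 1) (hc : ∀ a, α * a ≤ c a) (a : ℝ≥0) : α * a ≤ M.timeIter c a := by
  rcases eq_zero_or_pos a with rfl | ha
  · exact (mul_zero α).trans_le zero_le
  refine le_timeIter (mul_le_of_le_one_left zero_le hα₁) ?_
  refine le_trans ?_ (hsav (α * a) (mul_pos hα ha))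
  unfold savingValue
  gcongr with w
  refine hu.antitone_marg (le_trans ?_ (hc _))
  calc M.ret w * (1 - α) * (α * a) = α * (M.ret w * (a - α * a)) := by
        rw [mul_assoc, mul_left_comm (1 - α), tsub_mul, one_mul, mul_left_comm]
    _ ≤ α * M.nextWealth (a - α * a) w := by
        gcongr
        exact le_self_add

end TimeIteration

section LimitPolicy

variable {M : IncomeFluctuation Z E F} {α κ : ℝ≥0} {c : ℝ≥0 → ℝ≥0}

/-- Iterates of the time iteration operator started at the policy of consuming everything. -/
def policyIterate (M : IncomeFluctuation Z E F) (n : ℕ) : ℝ≥0 → ℝ≥0 := M.timeIter^[n] id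

/-- The limit of time iteration started at the policy of consuming everything, written as an
infimum because the iterates decrease. -/
def limitPolicy (M : IncomeFluctuation Z E F) (a : ℝ≥0) : ℝ≥0 := ⨅ n, M.policyIterate n a

lemma policyIterate_succ (n : ℕ) :
    M.policyIterate (n + 1) = M.timeIter (M.policyIterate n) :=
  Function.iterate_succ_apply' _ _ _

lemma limitPolicy_le (n : ℕ) (a : ℝ≥0) : M.limitPolicy a ≤ M.policyIterate n a :=
  ciInf_le (OrderBot.bddBelow _) n

lemma mul_le_limitPolicy (hsav : M.SavingInequality α) (hu : M.UtilityAssumption)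
    (hα : 0 < α) (hα₁ : α ≤ 1) (a : ℝ≥0) : α * a ≤ M.limitPolicy a := by
  refine le_ciInf fun n => ?_
  induction n generalizing a with
  | zero => exact mul_le_of_le_one_left zero_le hα₁
  | succ n ih =>
    rw [policyIterate_succ]
    exact hsav.mul_le_timeIter hu hα hα₁ ih a

lemma wealthPolicy_policyIterate (hu : M.UtilityAssumption) (hmom : M.MomentAssumption)
    (hκ : M.savingValueBound κ ≤ κ) (n : ℕ) : M.WealthPolicy κ (M.policyIterate n) := by
  induction n with
  | zero => exact wealthPolicy_id M κ
  | succ n ih =>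
    rw [policyIterate_succ]
    exact ih.timeIter hu hmom hκ

variable (hu : M.UtilityAssumption) (hmom : M.MomentAssumption)
  (hpol : ∀ n, M.WealthPolicy κ (M.policyIterate n))

include hu hmom hpol

lemma concaveOn_policyIterate [TopologicalSpace Z] (hconc : M.ConcavityAssumption) (n : ℕ) :
    ConcaveOn ℝ≥0 (Ioi 0) (M.policyIterate n) := by
  induction n with
  | zero => exact concaveOn_id (convex_Ioi 0)
  | succ n ih =>
    rw [policyIterate_succ]
    exact (hpol n).concaveOn_timeIter hu hmom hconc ih

lemma antitone_policyIterate : Antitone M.policyIterate := by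
  refine antitone_nat_of_succ_le fun n => ?_
  induction n with
  | zero =>
    rw [policyIterate_succ]
    exact timeIter_le_self _
  | succ n ih =>
    have hmono := (hpol (n + 1)).timeIter_mono hu hmom ih
    rwa [← policyIterate_succ, ← policyIterate_succ] at hmono

lemma tendsto_policyIterate (a : ℝ≥0) :
    Tendsto (fun n => M.policyIterate n a) atTop (𝓝 (M.limitPolicy a)) :=
  tendsto_atTop_ciInf (fun _ _ h => antitone_policyIterate hu hmom hpol h a) (OrderBot.bddBelow _)

lemma wealthPolicy_limitPolicy : M.WealthPolicy κ M.limitPolicy := by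
  have hlim := tendsto_policyIterate hu hmom hpol
  exact
  { mono := fun a b hab => le_of_tendsto_of_tendsto' (hlim a) (hlim b) fun n => (hpol n).mono hab
    le_add := fun a b hab => le_of_tendsto_of_tendsto' (hlim b) ((hlim a).add_const _)
      fun n => (hpol n).le_add a b hab
    le_self := fun a => limitPolicy_le 0 a
    marg_le := fun a => le_of_tendsto' ((hu.continuous_marg.tendsto _).comp (hlim a))
      fun n => (hpol n).marg_le a }

lemma concaveOn_limitPolicy [TopologicalSpace Z] (hconc : M.ConcavityAssumption) :
    ConcaveOn ℝ≥0 (Ioi 0) M.limitPolicy := by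
  have hlim := tendsto_policyIterate hu hmom hpol
  exact ⟨convex_Ioi 0, fun a ha b hb p q hp hq hpq =>
    le_of_tendsto_of_tendsto' (((hlim a).const_smul p).add ((hlim b).const_smul q)) (hlim _)
      fun n => (concaveOn_policyIterate hu hmom hpol hconc n).2 ha hb hp hq hpq⟩

lemma timeIter_limitPolicy : M.timeIter M.limitPolicy = M.limitPolicy := by
  have hpol_lim := wealthPolicy_limitPolicy hu hmom hpol
  have hlim := tendsto_policyIterate hu hmom hpol
  refine le_antisymm (fun a => ?_) (fun a => ?_)
  · refine ge_of_tendsto' ((hlim a).comp (tendsto_add_atTop_nat 1)) fun n => ?_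
    rw [Function.comp_apply, policyIterate_succ]
    exact hpol_lim.timeIter_mono hu hmom (limitPolicy_le n) a
  · refine le_timeIter (hpol_lim.le_self a) ?_
    refine le_of_tendsto' (tendsto_savingValue hu hmom hpol fun w => hlim _) fun n => ?_
    have hle := limitPolicy_le (M := M) (n + 1) a
    have heuler := (hpol n).savingValue_timeIter_le hu hmom a
    rw [← policyIterate_succ] at heuler
    exact ((antitone_savingValue hu (hpol n).mono (tsub_le_tsub_left hle a)).trans heuler).trans
      (hu.antitone_marg hle)

end LimitPolicy

/-- A wealth policy satisfying the Euler equation, with equality required only where something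
is saved. -/
structure EulerPolicy (M : IncomeFluctuation Z E F) (κ : ℝ≥0) (c : ℝ≥0 → ℝ≥0) : Prop
    extends M.WealthPolicy κ c where
  euler_le : ∀ a, M.savingValue c (a - c a) ≤ M.marg (c a)
  euler_eq : ∀ a, c a < a → M.savingValue c (a - c a) = M.marg (c a)

theorem eulerPolicy_limitPolicy {M : IncomeFluctuation Z E F} {κ : ℝ≥0}
    (hu : M.UtilityAssumption) (hmom : M.MomentAssumption)
    (hpol : ∀ n, M.WealthPolicy κ (M.policyIterate n)) : M.EulerPolicy κ M.limitPolicy := by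
  have hlim := wealthPolicy_limitPolicy hu hmom hpol
  have hfix := timeIter_limitPolicy hu hmom hpol
  refine ⟨hlim, fun a => ?_, fun a ha => ?_⟩
  · simpa only [hfix] using hlim.savingValue_timeIter_le hu hmom a
  · simpa only [hfix] using hlim.savingValue_timeIter_eq hu hmom (a := a) (by rwa [hfix])

section Paths

variable (M : IncomeFluctuation Z E F) (d : ℝ≥0 × Z → ℝ≥0) (a : ℝ≥0) (z : Z) (t : ℕ)

/-- The wealth `a_t` under the policy `d`, started at `(a, z)`. -/
def wealth (ω : ℕ → Z × E × F) : ℝ≥0 := (M.statePath d a z ω t).1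

/-- The consumption `d(a_t, z_t)` under the policy `d`, started at `(a, z)`. -/
def consumption (ω : ℕ → Z × E × F) : ℝ≥0 := d (M.statePath d a z ω t)

/-- The saving `a_t - d(a_t, z_t)` under the policy `d`, started at `(a, z)`. -/
def saving (ω : ℕ → Z × E × F) : ℝ≥0 := M.wealth d a z t ω - M.consumption d a z t ω

/-- The mean wealth `𝔼 a_t` under the policy `d`, started at `(a, z)`. -/
def meanWealth : ℝ≥0∞ := ∫⁻ ω, M.wealth d a z t ω ∂M.pathLaw

/-- The value `𝔼 u'(d(a_t, z_t)) X` of a random amount `X` of period-`t` goods, at the marginal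
utility of consumption under the policy `d`. -/
def shadowValue (X : (ℕ → Z × E × F) → ℝ≥0) : ℝ≥0∞ :=
  ∫⁻ ω, M.marg (M.consumption d a z t ω) * X ω ∂M.pathLaw

/-- The expected positive part of utility in period `t`. -/
def posUtility : ℝ≥0∞ := ∫⁻ ω, (M.u (M.consumption d a z t ω)).toENNReal ∂M.pathLaw

/-- The expected negative part of utility in period `t`. -/
def negUtility : ℝ≥0∞ := ∫⁻ ω, (-M.u (M.consumption d a z t ω)).toENNReal ∂M.pathLaw

lemma wealth_succ (ω : ℕ → Z × E × F) :
    M.wealth d a z (t + 1) ω = M.ret (ω t) * M.saving d a z t ω + M.inc (ω t) := rfl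

lemma wealth_succ_le (ω : ℕ → Z × E × F) :
    M.wealth d a z (t + 1) ω ≤ M.ret (ω t) * M.wealth d a z t ω + M.inc (ω t) := by
  rw [wealth_succ]
  gcongr
  exact tsub_le_self

lemma dependsOn_statePath : DependsOn (fun ω => M.statePath d a z ω t) (Iio t) := by
  induction t with
  | zero => exact fun _ _ _ => rfl
  | succ t ih =>
    intro ω ω' h
    simp only [statePath, h t (lt_add_one t), ih fun i hi => h i (Nat.lt_succ_of_lt hi)]

lemma dependsOn_wealth : DependsOn (M.wealth d a z t) (Iio t) := fun _ _ h =>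
  congrArg Prod.fst (M.dependsOn_statePath d a z t h)

lemma dependsOn_saving : DependsOn (M.saving d a z t) (Iio t) := fun _ _ h =>
  congrArg (fun s => s.1 - d s) (M.dependsOn_statePath d a z t h)

variable {M d a z t}

lemma Feasible.consumption_add_saving (hd : Feasible d) (ω : ℕ → Z × E × F) :
    M.consumption d a z t ω + M.saving d a z t ω = M.wealth d a z t ω :=
  add_tsub_cancel_of_le (hd.le _ _)

lemma measurable_statePath (hd : Measurable d) : Measurable fun ω => M.statePath d a z ω t := by
  induction t with
  | zero => exact measurable_const
  | succ t ih =>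
    simp only [statePath]
    fun_prop

@[fun_prop]
lemma measurable_wealth (hd : Measurable d) : Measurable (M.wealth d a z t) :=
  (measurable_statePath hd).fst

@[fun_prop]
lemma measurable_consumption (hd : Measurable d) : Measurable (M.consumption d a z t) :=
  hd.comp (measurable_statePath hd)

@[fun_prop]
lemma measurable_saving (hd : Measurable d) : Measurable (M.saving d a z t) :=
  (measurable_wealth hd).sub (measurable_consumption hd)

lemma lintegral_pathLaw_eval {G : (ℕ → Z × E × F) → Z × E × F → ℝ≥0∞}
    (hG : Measurable (Function.uncurry G)) (hdep : ∀ w, DependsOn (fun ω => G ω w) (Iio t)) :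
    ∫⁻ ω, G ω (ω t) ∂M.pathLaw = ∫⁻ ω, ∫⁻ w, G ω w ∂M.shock ∂M.pathLaw :=
  lintegral_infinitePi_eval_of_dependsOn (μ := fun _ : ℕ => M.shock) (i := t) hG fun w =>
    (hdep w).mono fun _ hi => (mem_Iio.1 hi).ne

lemma lintegral_mul_wealth_succ_le {h : Z × E × F → ℝ≥0∞} (hh : Measurable h)
    (hd : Measurable d) :
    ∫⁻ ω, h (ω t) * M.wealth d a z (t + 1) ω ∂M.pathLaw
      ≤ (∫⁻ w, h w * M.ret w ∂M.shock) * M.meanWealth d a z t + ∫⁻ w, h w * M.inc w ∂M.shock := by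
  calc ∫⁻ ω, h (ω t) * M.wealth d a z (t + 1) ω ∂M.pathLaw
      ≤ ∫⁻ ω, h (ω t) * (M.ret (ω t) * M.wealth d a z t ω + M.inc (ω t)) ∂M.pathLaw := by
        gcongr with ω
        exact_mod_cast M.wealth_succ_le d a z t ω
    _ = ∫⁻ ω, ∫⁻ w, h w * (M.ret w * M.wealth d a z t ω + M.inc w) ∂M.shock ∂M.pathLaw :=
        lintegral_pathLaw_eval
          (G := fun ω w => h w * (M.ret w * M.wealth d a z t ω + M.inc w)) (by fun_prop)
          fun w ω ω' hω => by simp only [M.dependsOn_wealth d a z t hω]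
    _ = ∫⁻ ω, ((∫⁻ w, h w * M.ret w ∂M.shock) * M.wealth d a z t ω
          + ∫⁻ w, h w * M.inc w ∂M.shock) ∂M.pathLaw := by
        refine lintegral_congr fun ω => ?_
        rw [← lintegral_mul_const _ (by fun_prop), ← lintegral_add_right _ (by fun_prop)]
        simp only [mul_add, mul_assoc]
    _ = _ := by
        rw [lintegral_add_right _ measurable_const, lintegral_const_mul _ (by fun_prop),
          lintegral_const, measure_univ, mul_one, meanWealth]

end Paths

section Transversality

variable {M : IncomeFluctuation Z E F} {κ : ℝ≥0} {c : ℝ≥0 → ℝ≥0} {d : ℝ≥0 × Z → ℝ≥0}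
  {a : ℝ≥0} {z : Z}

lemma discount_lt_one (M : IncomeFluctuation Z E F) : (M.β : ℝ≥0∞) < 1 := by
  exact_mod_cast M.β_lt_one

lemma tsum_meanWealth_ne_top (hθ : M.β * M.meanRet < 1) (hinc : M.meanInc ≠ ⊤)
    (hd : Measurable d) : ∑' t, (M.β : ℝ≥0∞) ^ t * M.meanWealth d a z t ≠ ⊤ := by
  refine tsum_pow_mul_ne_top_of_recursion M.discount_lt_one hθ hinc ?_ fun t => ?_
  · simp [meanWealth, wealth, statePath]
  · have hbound := lintegral_mul_wealth_succ_le (M := M) (h := fun _ => 1) (a := a) (z := z)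
      (t := t) measurable_const hd
    simpa only [one_mul, meanRet, meanInc, meanWealth] using hbound

lemma tsum_posUtility_ne_top (hu : M.UtilityAssumption) (hθ : M.β * M.meanRet < 1)
    (hinc : M.meanInc ≠ ⊤) (hd : Feasible d) :
    ∑' t, (M.β : ℝ≥0∞) ^ t * M.posUtility d a z t ≠ ⊤ := by
  have hdm := hd.measurable
  refine tsum_pow_mul_ne_top_of_le (A := M.marg 1) (B := (M.u 1).toENNReal)
    (g := M.meanWealth d a z) M.discount_lt_one (mt marg_eq_top_iff.1 one_ne_zero)
    (by simpa using hu.ne_top 1)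
    (tsum_meanWealth_ne_top hθ hinc hdm) fun t => ?_
  calc M.posUtility d a z t
      ≤ ∫⁻ ω, (M.marg 1 * M.wealth d a z t ω + (M.u 1).toENNReal) ∂M.pathLaw := by
        unfold posUtility
        gcongr with ω
        rw [add_comm]
        exact (hu.toENNReal_u_le _).trans (by gcongr; exact hd.le _ _)
    _ = M.marg 1 * M.meanWealth d a z t + (M.u 1).toENNReal := by
        rw [lintegral_add_right _ measurable_const, lintegral_const_mul _ (by fun_prop),
          lintegral_const, measure_univ, mul_one, meanWealth]

lemma lintegral_marg_add_mul_inc_ne_top (hu : M.UtilityAssumption) (hmom : M.MomentAssumption)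
    (hinc : M.meanInc ≠ ⊤) (κ : ℝ≥0) :
    ∫⁻ w, (M.marg (M.inc w) + κ) * M.inc w ∂M.shock ≠ ⊤ := by
  have hmarg := hu.measurable_marg
  have hle : ∫⁻ w, (M.marg (M.inc w) + κ) * M.inc w ∂M.shock
      ≤ ∫⁻ w, (M.marg (M.inc w) + (M.marg 1 + κ) * M.inc w) ∂M.shock := by
    gcongr with w
    rw [add_mul, add_mul, ← add_assoc]
    gcongr
    exact hu.marg_mul_self_le _
  refine ne_top_of_le_ne_top ?_ hle
  rw [lintegral_add_left (by fun_prop), lintegral_const_mul _ (by fun_prop)]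
  exact ENNReal.add_ne_top.2 ⟨hmom.2.1.ne, ENNReal.mul_ne_top
    (ENNReal.add_ne_top.2 ⟨mt marg_eq_top_iff.1 one_ne_zero, ENNReal.coe_ne_top⟩) hinc⟩

namespace WealthPolicy

variable (hc : M.WealthPolicy κ c) (hu : M.UtilityAssumption) (hmom : M.MomentAssumption)
  (ha : 0 < a)

include hc in
lemma feasible : Feasible fun s : ℝ≥0 × Z => c s.1 :=
  ⟨hc.measurable.comp measurable_fst, fun a _ => hc.le_self a⟩

include hc hu in
lemma marg_consumption_succ_le (t : ℕ) (ω : ℕ → Z × E × F) :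
    M.marg (M.consumption (fun s => c s.1) a z (t + 1) ω) ≤ M.marg (M.inc (ω t)) + κ :=
  hc.marg_nextWealth_le hu _ _

include hc ha in
lemma shadowValue_zero_ne_top {x : ℝ≥0} :
    M.shadowValue (fun s => c s.1) a z 0 (fun _ => x) ≠ ⊤ := by
  simpa [shadowValue, consumption, statePath] using
    ENNReal.mul_ne_top (mt marg_eq_top_iff.1 (hc.pos ha).ne') (ENNReal.coe_ne_top (r := x))

include hc hu hmom ha

lemma tsum_shadowValue_wealth_ne_top (hθ : M.β * M.meanRet < 1) (hinc : M.meanInc ≠ ⊤)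
    (hd : Measurable d) :
    ∑' t, (M.β : ℝ≥0∞) ^ t * M.shadowValue (fun s => c s.1) a z t (M.wealth d a z t) ≠ ⊤ := by
  have hmarg := hu.measurable_marg
  have hret : ∫⁻ w, (M.marg (M.inc w) + κ) * M.ret w ∂M.shock ≠ ⊤ := by
    simpa only [mul_comm] using lintegral_ret_mul_marg_add_ne_top hmom κ
  refine tsum_pow_mul_ne_top_of_succ_le (g := M.meanWealth d a z) M.discount_lt_one hret
    (lintegral_marg_add_mul_inc_ne_top hu hmom hinc κ)
    (tsum_meanWealth_ne_top hθ hinc hd) (hc.shadowValue_zero_ne_top ha) fun t => ?_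
  refine le_trans ?_ (lintegral_mul_wealth_succ_le (by fun_prop) hd)
  unfold shadowValue
  gcongr with ω
  exact hc.marg_consumption_succ_le hu t ω

lemma tsum_shadowValue_one_ne_top :
    ∑' t, (M.β : ℝ≥0∞) ^ t * M.shadowValue (fun s => c s.1) a z t 1 ≠ ⊤ := by
  have hmarg := hu.measurable_marg
  refine tsum_pow_mul_ne_top_of_succ_le (g := 0) (A := 0)
    (B := ∫⁻ w, (M.marg (M.inc w) + κ) ∂M.shock) M.discount_lt_one ENNReal.zero_ne_top ?_
    (by simp) (hc.shadowValue_zero_ne_top ha) fun t => ?_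
  · rw [lintegral_add_right _ measurable_const]
    simpa using hmom.2.1.ne
  · rw [zero_mul, zero_add, ← lintegral_infinitePi_eval (μ := fun _ : ℕ => M.shock) (i := t)
      (f := fun w => M.marg (M.inc w) + κ) (by fun_prop)]
    refine lintegral_mono fun ω => ?_
    simpa using hc.marg_consumption_succ_le hu t ω

lemma tsum_negUtility_ne_top :
    ∑' t, (M.β : ℝ≥0∞) ^ t * M.negUtility (fun s => c s.1) a z t ≠ ⊤ := by
  have hu₁ : (-M.u 1).toENNReal ≠ ⊤ := by simpa using hu.ne_bot 1 one_pos
  refine tsum_pow_mul_ne_top_of_le (g := fun t => M.shadowValue (fun s => c s.1) a z t 1)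
    M.discount_lt_one ENNReal.one_ne_top hu₁
    (hc.tsum_shadowValue_one_ne_top hu hmom ha) fun t => ?_
  calc M.negUtility (fun s => c s.1) a z t
      ≤ ∫⁻ ω, (M.marg (M.consumption (fun s => c s.1) a z t ω) + (-M.u 1).toENNReal)
          ∂M.pathLaw := by
        unfold negUtility
        gcongr with ω
        rw [add_comm]
        exact hu.toENNReal_neg_u_le _
    _ = 1 * M.shadowValue (fun s => c s.1) a z t 1 + (-M.u 1).toENNReal := by
        rw [lintegral_add_right _ measurable_const, lintegral_const, measure_univ, mul_one,
          one_mul, shadowValue]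
        simp

end WealthPolicy

end Transversality

section Verification

variable {M : IncomeFluctuation Z E F} {κ : ℝ≥0} {c : ℝ≥0 → ℝ≥0} {d p : ℝ≥0 × Z → ℝ≥0}
  {a : ℝ≥0} {z : Z} {t : ℕ}

lemma shadowValue_add (hu : M.UtilityAssumption) (hp : Measurable p)
    {X X' : (ℕ → Z × E × F) → ℝ≥0} (hX : Measurable X) :
    M.shadowValue p a z t (X + X') = M.shadowValue p a z t X + M.shadowValue p a z t X' := by
  have hmarg := hu.measurable_marg
  simp only [shadowValue, Pi.add_apply, ENNReal.coe_add, mul_add]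
  exact lintegral_add_left (by fun_prop) _

lemma shadowValue_wealth (hu : M.UtilityAssumption) (hp : Measurable p) (hd : Feasible d) :
    M.shadowValue p a z t (M.wealth d a z t)
      = M.shadowValue p a z t (M.consumption d a z t)
        + M.shadowValue p a z t (M.saving d a z t) := by
  rw [← shadowValue_add hu hp (measurable_consumption hd.measurable)]
  exact congrArg _ (funext fun ω => (hd.consumption_add_saving ω).symm)

lemma mul_shadowValue_succ_ret_mul (hu : M.UtilityAssumption) (hc : Measurable c)
    {X : (ℕ → Z × E × F) → ℝ≥0} (hX : Measurable X) (hdep : DependsOn X (Iio t)) :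
    M.β * M.shadowValue (fun s => c s.1) a z (t + 1) (fun ω => M.ret (ω t) * X ω)
      = ∫⁻ ω, M.savingValue c (M.saving (fun s => c s.1) a z t ω) * X ω ∂M.pathLaw := by
  have hmarg := hu.measurable_marg
  have hcond : M.shadowValue (fun s => c s.1) a z (t + 1) (fun ω => M.ret (ω t) * X ω)
      = ∫⁻ ω, ∫⁻ w, M.marg (c (M.nextWealth (M.saving (fun s => c s.1) a z t ω) w))
          * (M.ret w * X ω : ℝ≥0) ∂M.shock ∂M.pathLaw :=
    lintegral_pathLaw_eval (G := fun ω w =>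
        M.marg (c (M.nextWealth (M.saving (fun s => c s.1) a z t ω) w)) * (M.ret w * X ω : ℝ≥0))
      (by fun_prop) fun w ω ω' hω => by
        simp only [M.dependsOn_saving _ a z t hω, hdep hω]
  rw [hcond, ← lintegral_const_mul' _ _ ENNReal.coe_ne_top]
  refine lintegral_congr fun ω => ?_
  rw [savingValue, mul_assoc, ← lintegral_mul_const _ (measurable_ret_mul_marg hu hc _)]
  simp only [ENNReal.coe_mul]
  congr 2 with w
  ring

lemma mul_shadowValue_succ_wealth (hu : M.UtilityAssumption) (hc : Measurable c)
    (hd : Measurable d) :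
    M.β * M.shadowValue (fun s => c s.1) a z (t + 1) (M.wealth d a z (t + 1))
      = ∫⁻ ω, M.savingValue c (M.saving (fun s => c s.1) a z t ω) * M.saving d a z t ω ∂M.pathLaw
        + M.β * M.shadowValue (fun s => c s.1) a z (t + 1) (fun ω => M.inc (ω t)) := by
  rw [← mul_shadowValue_succ_ret_mul hu hc (measurable_saving hd) (M.dependsOn_saving d a z t),
    ← mul_add, ← shadowValue_add hu (by fun_prop) (by fun_prop)]
  rfl

/-- Complementary slackness: the difference of the two sides is
`(u'(c(a)) - savingValue c (a - c(a))) * (y - (a - c(a)))`, whose first factor is nonnegative and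
vanishes unless nothing is saved at `a`. -/
lemma EulerPolicy.savingValue_mul_add_le (hc : M.EulerPolicy κ c) (a y : ℝ≥0) :
    M.savingValue c (a - c a) * y + M.marg (c a) * (a - c a : ℝ≥0)
      ≤ M.marg (c a) * y + M.savingValue c (a - c a) * (a - c a : ℝ≥0) := by
  rcases (hc.le_self a).eq_or_lt with heq | hlt
  · have hle := hc.euler_le a
    simp only [heq, tsub_self, ENNReal.coe_zero, mul_zero, add_zero] at hle ⊢
    gcongr
  · rw [hc.euler_eq a hlt]

lemma EulerPolicy.mul_shadowValue_succ_add_le (hc : M.EulerPolicy κ c)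
    (hu : M.UtilityAssumption) (hd : Measurable d) :
    M.β * M.shadowValue (fun s => c s.1) a z (t + 1) (M.wealth d a z (t + 1))
        + M.shadowValue (fun s => c s.1) a z t (M.saving (fun s => c s.1) a z t)
      ≤ M.shadowValue (fun s => c s.1) a z t (M.saving d a z t)
        + M.β * M.shadowValue (fun s => c s.1) a z (t + 1)
          (M.wealth (fun s => c s.1) a z (t + 1)) := by
  have hcm := hc.measurable
  have hmarg := hu.measurable_marg
  have hpm : Measurable fun s : ℝ≥0 × Z => c s.1 := by fun_prop
  have hmul (X : (ℕ → Z × E × F) → ℝ≥0) (hX : Measurable X) : Measurable fun ω =>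
      M.marg (M.consumption (fun s => c s.1) a z t ω) * X ω := by fun_prop
  rw [mul_shadowValue_succ_wealth hu hcm hd, mul_shadowValue_succ_wealth hu hcm hpm, ← add_assoc,
    add_right_comm]
  refine add_le_add ?_ le_rfl
  unfold shadowValue
  rw [← lintegral_add_right _ (hmul _ (measurable_saving hpm)),
    ← lintegral_add_left (hmul _ (measurable_saving hd))]
  exact lintegral_mono fun ω => hc.savingValue_mul_add_le (M.wealth (fun s => c s.1) a z t ω) _

lemma posUtility_add_le (hu : M.UtilityAssumption) (hp : Measurable p) (hd : Measurable d) :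
    M.posUtility d a z t + M.negUtility p a z t
        + M.shadowValue p a z t (M.consumption p a z t)
      ≤ M.posUtility p a z t + M.negUtility d a z t
        + M.shadowValue p a z t (M.consumption d a z t) := by
  have hmu := hu.measurable_u
  unfold posUtility negUtility shadowValue
  rw [← lintegral_add_left (by fun_prop), ← lintegral_add_left (by fun_prop),
    ← lintegral_add_left (by fun_prop), ← lintegral_add_left (by fun_prop)]
  exact lintegral_mono fun ω => hu.toENNReal_u_add_le _ _

lemma posUtility_zero_add_lt (hu : M.UtilityAssumption) (hp : 0 < p (a, z))
    (hne : d (a, z) ≠ p (a, z)) :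
    M.posUtility d a z 0 + M.negUtility p a z 0
        + M.shadowValue p a z 0 (M.consumption p a z 0)
      < M.posUtility p a z 0 + M.negUtility d a z 0
        + M.shadowValue p a z 0 (M.consumption d a z 0) := by
  simpa [posUtility, negUtility, shadowValue, consumption, statePath] using
    hu.toENNReal_u_add_lt hp hne

lemma lifetimeValue_eq (hu : M.UtilityAssumption) (hd : Measurable d) :
    M.lifetimeValue d a z = ((∑' t, (M.β : ℝ≥0∞) ^ t * M.posUtility d a z t : ℝ≥0∞) : EReal)
      - (∑' t, (M.β : ℝ≥0∞) ^ t * M.negUtility d a z t : ℝ≥0∞) := by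
  have hmu := hu.measurable_u
  have hcons (t : ℕ) : Measurable fun ω => d (M.statePath d a z ω t) := measurable_consumption hd
  have hterm {f : ℝ≥0 → ℝ≥0∞} (hf : Measurable f) (t : ℕ) :
      AEMeasurable (fun ω => (M.β : ℝ≥0∞) ^ t * f (d (M.statePath d a z ω t))) M.pathLaw :=
    ((hf.comp (hcons t)).const_mul _).aemeasurable
  unfold lifetimeValue posUtility negUtility
  rw [lintegral_tsum (hterm (f := fun x => (M.u x).toENNReal) (by fun_prop)),
    lintegral_tsum (hterm (f := fun x => (-M.u x).toENNReal) (by fun_prop))]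
  simp only [lintegral_const_mul' _ _ (ENNReal.pow_ne_top ENNReal.coe_ne_top)]
  rfl

namespace EulerPolicy

variable (hc : M.EulerPolicy κ c) (hu : M.UtilityAssumption)

include hc hu

/-- The sum of the tangent inequality for utility and the integrated Euler equation; summed over
`t` with weights `β ^ t`, the shadow values of wealth telescope. -/
lemma posUtility_add_shadowValue_le (hd : Feasible d) (t : ℕ) :
    M.posUtility d a z t + M.negUtility (fun s => c s.1) a z t
        + M.β * M.shadowValue (fun s => c s.1) a z (t + 1) (M.wealth d a z (t + 1))
        + M.shadowValue (fun s => c s.1) a z t (M.wealth (fun s => c s.1) a z t)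
      ≤ M.posUtility (fun s => c s.1) a z t + M.negUtility d a z t
        + M.shadowValue (fun s => c s.1) a z t (M.wealth d a z t)
        + M.β * M.shadowValue (fun s => c s.1) a z (t + 1)
          (M.wealth (fun s => c s.1) a z (t + 1)) := by
  have hp := hc.feasible (Z := Z)
  have htangent := posUtility_add_le (a := a) (z := z) (t := t) hu hp.measurable hd.measurable
  have heuler := hc.mul_shadowValue_succ_add_le (a := a) (z := z) (t := t) hu hd.measurable
  rw [shadowValue_wealth (t := t) hu hp.measurable hd,
    shadowValue_wealth (t := t) hu hp.measurable hp]
  convert add_le_add htangent heuler using 1 <;> ac_rfl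

variable (hmom : M.MomentAssumption) (hθ : M.β * M.meanRet < 1) (hinc : M.meanInc ≠ ⊤)
  (hd : Feasible d) (ha : 0 < a)

include hmom hθ hinc hd ha

lemma posUtility_zero_add_shadowValue_lt (hne : d (a, z) ≠ c a) :
    M.posUtility d a z 0 + M.negUtility (fun s => c s.1) a z 0
        + M.β * M.shadowValue (fun s => c s.1) a z 1 (M.wealth d a z 1)
        + M.shadowValue (fun s => c s.1) a z 0 (M.wealth (fun s => c s.1) a z 0)
      < M.posUtility (fun s => c s.1) a z 0 + M.negUtility d a z 0
        + M.shadowValue (fun s => c s.1) a z 0 (M.wealth d a z 0)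
        + M.β * M.shadowValue (fun s => c s.1) a z 1 (M.wealth (fun s => c s.1) a z 1) := by
  have hp := hc.feasible (Z := Z)
  have hnext : M.β * M.shadowValue (fun s => c s.1) a z 1 (M.wealth d a z 1) ≠ ⊤ := by
    simpa using ENNReal.ne_top_of_tsum_ne_top
      (hc.tsum_shadowValue_wealth_ne_top (z := z) hu hmom ha hθ hinc hd.measurable) 1
  have hsaving : M.shadowValue (fun s => c s.1) a z 0 (M.saving (fun s => c s.1) a z 0) ≠ ⊤ :=
    hc.shadowValue_zero_ne_top (x := a - c a) ha
  have hsum := ENNReal.add_lt_add_of_lt_of_le (ENNReal.add_ne_top.2 ⟨hnext, hsaving⟩)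
    (posUtility_zero_add_lt hu (p := fun s => c s.1) (hc.pos ha) hne)
    (hc.mul_shadowValue_succ_add_le (a := a) (z := z) (t := 0) hu hd.measurable)
  rw [shadowValue_wealth (t := 0) hu hp.measurable hd,
    shadowValue_wealth (t := 0) hu hp.measurable hp]
  convert hsum using 1 <;> ac_rfl

theorem lifetimeValue_le : M.lifetimeValue d a z ≤ M.lifetimeValue (fun s => c s.1) a z := by
  have hp := hc.feasible (Z := Z)
  have htrans {e : ℝ≥0 × Z → ℝ≥0} (he : Measurable e) :=
    hc.tsum_shadowValue_wealth_ne_top (z := z) hu hmom ha hθ hinc he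
  rw [lifetimeValue_eq hu hd.measurable, lifetimeValue_eq hu hp.measurable]
  refine coe_ennreal_sub_le_sub (hc.tsum_negUtility_ne_top hu hmom ha) ?_
  simp only [← ENNReal.tsum_add, ← mul_add]
  exact tsum_pow_mul_le_of_telescope (hc.posUtility_add_shadowValue_le hu hd) (by rfl)
    (htrans hd.measurable) (htrans hp.measurable)

theorem lifetimeValue_lt (hne : d (a, z) ≠ c a) :
    M.lifetimeValue d a z < M.lifetimeValue (fun s => c s.1) a z := by
  have hp := hc.feasible (Z := Z)
  have htrans {e : ℝ≥0 × Z → ℝ≥0} (he : Measurable e) :=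
    hc.tsum_shadowValue_wealth_ne_top (z := z) hu hmom ha hθ hinc he
  have hneg := hc.tsum_negUtility_ne_top (z := z) hu hmom ha
  have hpos := tsum_posUtility_ne_top (a := a) (z := z) hu hθ hinc hd
  rw [lifetimeValue_eq hu hd.measurable, lifetimeValue_eq hu hp.measurable]
  refine coe_ennreal_sub_lt_sub hneg ?_
  have hfin := ENNReal.add_ne_top.2 ⟨hpos, hneg⟩
  simp only [← ENNReal.tsum_add, ← mul_add] at hfin ⊢
  exact tsum_pow_mul_lt_of_telescope (hc.posUtility_add_shadowValue_le hu hd) (by rfl)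
    (htrans hd.measurable) (htrans hp.measurable) hfin
    (hc.posUtility_zero_add_shadowValue_lt hu hmom hθ hinc hd ha hne)

end EulerPolicy

end Verification

section Stability

variable {M : IncomeFluctuation Z E F} {α κ : ℝ≥0} {c : ℝ≥0 → ℝ≥0}

/-- The concave function `c a - α a` is bounded below, so it is increasing. -/
lemma mul_sub_le_of_concaveOn (hconc : ConcaveOn ℝ≥0 (Ioi 0) c) (hα : ∀ a, α * a ≤ c a)
    {a b : ℝ≥0} (ha : 0 < a) (hab : a ≤ b) : (α : ℝ) * (b - a) ≤ c b - c a := by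
  have hconc' : ConcaveOn ℝ (Ioi 0) fun x : ℝ => (c x.toNNReal : ℝ) - α * x :=
    (concaveOn_coe_toNNReal hconc).sub ((convexOn_id (convex_Ioi 0)).smul α.coe_nonneg)
  have hmono := monotoneOn_Ioi_of_concaveOn_of_le (b := 0) hconc' fun x hx => by
    have := NNReal.coe_le_coe.2 (hα x.toNNReal)
    rw [NNReal.coe_mul, Real.coe_toNNReal x (le_of_lt hx)] at this
    exact sub_nonneg.2 this
  have := hmono (show (0 : ℝ) < a from ha) (show (0 : ℝ) < b from ha.trans_le hab) hab
  simp only [Real.toNNReal_coe] at this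
  linarith

lemma WealthPolicy.lipschitzWith_sub (hc : M.WealthPolicy κ c)
    (hconc : ConcaveOn ℝ≥0 (Ioi 0) c) (hα : ∀ a, α * a ≤ c a) :
    LipschitzWith (1 - α) fun a => a - c a := by
  have hα₁ : α ≤ 1 := by simpa using (hα 1).trans (hc.le_self 1)
  refine LipschitzWith.of_dist_le_mul fun a b => ?_
  wlog hab : b ≤ a generalizing a b
  · rw [dist_comm, dist_comm a]
    exact this b a (le_of_not_ge hab)
  have hslope : (α : ℝ) * (a - b) ≤ c a - c b := by
    rcases eq_zero_or_pos b with rfl | hb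
    · have hc0 : c 0 = 0 := nonpos_iff_eq_zero.1 (hc.le_self 0)
      simpa [hc0] using NNReal.coe_le_coe.2 (hα a)
    · exact mul_sub_le_of_concaveOn hconc hα hb hab
  have hsave : (c a : ℝ) ≤ c b + (a - b) := by
    simpa [NNReal.coe_sub hab] using NNReal.coe_le_coe.2 (hc.le_add b a hab)
  rw [NNReal.dist_eq, NNReal.dist_eq, NNReal.coe_sub (hc.le_self a),
    NNReal.coe_sub (hc.le_self b), NNReal.coe_sub hα₁, NNReal.coe_one,
    abs_of_nonneg (by linarith), abs_of_nonneg (by linarith)]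
  linarith

lemma lipschitzWith_nextWealth (M : IncomeFluctuation Z E F) (w : Z × E × F) :
    LipschitzWith (M.ret w) fun s => M.nextWealth s w := by
  refine LipschitzWith.of_dist_le_mul fun s t => le_of_eq ?_
  simp only [nextWealth, NNReal.dist_eq, NNReal.coe_add, NNReal.coe_mul, add_sub_add_right_eq_sub,
    ← mul_sub, abs_mul, NNReal.abs_eq]

theorem WealthPolicy.globallyStable_wealthKernel (hc : M.WealthPolicy κ c)
    (hconc : ConcaveOn ℝ≥0 (Ioi 0) c) (hα : ∀ a, α * a ≤ c a)
    (hcontr : (1 - α : ℝ≥0) * M.meanRet < 1) (hinc : M.meanInc ≠ ⊤) :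
    GloballyStable (M.wealthKernel c) := by
  have hcm := hc.measurable
  have hsave := hc.lipschitzWith_sub hconc hα
  refine globallyStable_randomMapKernel (Φ := fun w a => M.nextWealth (a - c a) w)
    (L := fun w => M.ret w * (1 - α)) (x₀ := 0) (by fun_prop)
    (fun w => (M.lipschitzWith_nextWealth w).comp hsave) (by fun_prop) ?_ ?_
  · simp only [ENNReal.coe_mul]
    rwa [lintegral_mul_const _ (by fun_prop), mul_comm]
  · simpa [nextWealth, meanInc, edist_nndist, nndist_comm] using hinc

end Stability

end

end IncomeFluctuation

open IncomeFluctuation in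
theorem theoremt_general {Z E F : Type*} [MeasurableSpace Z] [MeasurableSpace E]
    [MeasurableSpace F] [TopologicalSpace Z] (M : IncomeFluctuation Z E F)
    (hu : M.UtilityAssumption) (hcontr : M.ContractionAssumption) (hmom : M.MomentAssumption)
    (hsav : M.SavingAssumption) (hYbd : M.IncomeBoundAssumption)
    (hconc : M.ConcavityAssumption) :
    ∃ c : ℝ≥0 → ℝ≥0, M.Optimal (fun s => c s.1) ∧
      (∀ d, M.Optimal d → d = fun s => c s.1) ∧
      M.Candidate (fun s => c s.1) ∧ GloballyStable (M.wealthKernel c) := by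
  obtain ⟨α, hα, hα₁, hsav_le, n, hn⟩ := hsav
  have hθ := hcontr.mul_meanRet_lt_one
  have hinc := hYbd.meanInc_ne_top
  obtain ⟨κ, hκ⟩ := exists_savingValueBound_le hmom hθ
  have hpol := wealthPolicy_policyIterate hu hmom hκ
  have heuler := eulerPolicy_limitPolicy hu hmom hpol
  have hfeas : Feasible fun s : ℝ≥0 × Z => M.limitPolicy s.1 := heuler.feasible
  refine ⟨M.limitPolicy, ⟨hfeas, fun d hd a z ha =>
    heuler.lifetimeValue_le hu hmom hθ hinc hd ha⟩, fun d hd => ?_, heuler.candidate hu,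
    heuler.globallyStable_wealthKernel (concaveOn_limitPolicy hu hmom hpol hconc)
      (mul_le_limitPolicy hsav_le hu hα hα₁.le) (mul_meanRet_lt_one hn) hinc⟩
  funext ⟨a, z⟩
  rcases eq_zero_or_pos a with rfl | ha
  · exact (nonpos_iff_eq_zero.1 (hd.1.le 0 z)).trans
      (nonpos_iff_eq_zero.1 (heuler.le_self 0)).symm
  · by_contra hne
    exact (heuler.lifetimeValue_lt hu hmom hθ hinc hd.1 ha hne).not_ge (hd.2 _ hfeas a z ha)

theorem theoremt {m : ℕ} (Z : Set (EuclideanSpace ℝ (Fin m))) (hZ : MeasurableSet Z)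
    {E F : Type*} [MeasurableSpace E] [MeasurableSpace F] (M : IncomeFluctuation Z E F)
    (hu : M.UtilityAssumption)
    (hcontr : M.ContractionAssumption)
    (hYsum : M.IncomeSumAssumption)
    (hmom : M.MomentAssumption)
    (hcont : M.ContinuityAssumption)
    (hsav : M.SavingAssumption)
    (hYbd : M.IncomeBoundAssumption)
    (hconc : M.ConcavityAssumption) :
    ∃ c : ℝ≥0 → ℝ≥0,
      -- the policy `(a, z) ↦ c a` is the unique optimal policy, and a candidate policy
      M.Optimal (fun s => c s.1) ∧
      (∀ d : ℝ≥0 × Z → ℝ≥0, M.Optimal d → d = fun s => c s.1) ∧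
      M.Candidate (fun s => c s.1) ∧
      -- the wealth process under it is globally stable
      GloballyStable (M.wealthKernel c) :=
  theoremt_general M hu hcontr hmom hsav hYbd hconc
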